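/- Let $d\in\mathbb{N}$. Let $\rho\in\mathcal{S}(\mathbb{R}^d)$ be even with $\int\rho(x)\,dx=1$ and $\int x^m\rho(x)\,dx=0$ for all $m\in\mathbb{N}^d\setminus\{0\}$, and let $\chi\in\mathcal{D}(\mathbb{R}^d)$ satisfy $0\le\chi\le1$, $\chi\equiv1$ on $\overline{B(0,1)}$ and $\chi\equiv0$ on $\mathbb{R}^d\setminus B(0,2)$. For $\varepsilon\in(0,1)$ put $$\theta_\varepsilon(x)=\varepsilon^{-d}\rho(x/\varepsilon)\,\chi(x|\ln\varepsilon|),\qquad x\in\mathbb{R}^d .$$ Let $C^\infty(\mathbb{R}^d)$ be the algebra of complex valued smooth functions and, for compact $K\subset\mathbb{R}^d$ and $l\in\mathbb{N}$, let $p_{K,l}(f)=\sup_{x\in K,\,|\alpha|\le l}|\partial^\alpha f(x)|$. A net $(f_\varepsilon)_\varepsilon\in C^\infty(\mathbb{R}^d)^{(0,1]}$ is called moderate if for all $l$ and $K$ there is $q\in\mathbb{N}$ with $p_{K,l}(f_\varepsilon)=o(\varepsilon^{-q})$ as $\varepsilon\to0$, and negligible if for all $l$, $K$ and all $p\in\mathbb{N}$,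 $p_{K,l}(f_\varepsilon)=o(\varepsilon^{p})$ as $\varepsilon\to0$. Let $\mathcal{G}(\mathbb{R}^d)$ be the quotient of the algebra of moderate nets by the ideal of negligible nets, write $[(f_\varepsilon)_\varepsilon]$ for the class of a moderate net, and let $\sigma:C^\infty(\mathbb{R}^d)\to\mathcal{G}(\mathbb{R}^d)$, $\sigma(f)=[(f)_\varepsilon]$, be the constant embedding. For a complex valued distribution $T\in\mathcal{D}'(\mathbb{R}^d)$ and $0<\varepsilon<1$ put $(T*\theta_\varepsilon)(y)=\langle T,\theta_\varepsilon(y-\cdot)\rangle$. Then, for every $T\in\mathcal{D}'(\mathbb{R}^d)$, the net $(T*\theta_\varepsilon)_\varepsilon$, completed at $\varepsilon=1$ by an arbitrary smooth function, is a moderate net of smooth functions whose class in $\mathcal{G}(\mathbb{R}^d)$ does not depend on the function chosen at $\varepsilon=1$. The resulting map $$\iota_S:\mathcal{D}'(\mathbb{R}^d)\to\mathcal{G}(\mathbb{R}^d),\qquad T\mapsto[(T*\theta_\varepsilon)_\varepsilon],$$ is $\mathbb{C}$-linear and injective, and $\iota_S(f)=\sigma(f)$ for every $f\in C^\infty(\mathbb{R}^d)$,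 where $f$ is identified with the distribution $\varphi\mapsto\int f(x)\varphi(x)\,dx$. -/

import Mathlib

open Set Filter Topology MeasureTheory TopologicalSpace
open scoped Distributions SchwartzMap ContDiff

noncomputable section

namespace Colombeau

/-- The Euclidean space `ℝ^d`. -/
abbrev E (d : ℕ) : Type := EuclideanSpace ℝ (Fin d)

/-- The parameter set `(0, 1]` of the nets. -/
abbrev I01 : Type := Set.Ioc (0 : ℝ) 1

/-- The filter `ε → 0` on `(0, 1]`. -/
def toZero : Filter I01 := Filter.comap (fun ε : I01 => (ε : ℝ)) (𝓝 0)

/-- The algebra `C^∞(ℝ^d)` of complex valued smooth functions. -/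
def SmoothFun (d : ℕ) : Subalgebra ℂ (E d → ℂ) where
  carrier := {f | ContDiff ℝ ∞ f}
  mul_mem' := fun {f g} hf hg => by
    have hf : ContDiff ℝ ∞ f := hf
    have hg : ContDiff ℝ ∞ g := hg
    exact hf.mul hg
  add_mem' := fun {f g} hf hg => by
    have hf : ContDiff ℝ ∞ f := hf
    have hg : ContDiff ℝ ∞ g := hg
    exact hf.add hg
  algebraMap_mem' := fun c => by
    have h : ContDiff ℝ ∞ (fun _ : E d => c) := contDiff_const
    exact h

/-- The seminorm `p_{K,l}(f)`, the supremum over `x ∈ K` of all the derivatives of `f` of order at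
most `l`; the derivatives of order `k` are collected in the `k`-linear map `D^k f(x)`, whose norm
is equivalent to the maximum of the `|∂^α f(x)|` with `|α| = k`. -/
def pSemi {d : ℕ} (K : Compacts (E d)) (l : ℕ) (f : E d → ℂ) : ℝ :=
  ⨆ z : Fin (l + 1) × (K : Set (E d)), ‖iteratedFDeriv ℝ (z.1 : ℕ) f (z.2 : E d)‖

section pSemi

variable {d : ℕ} (K : Compacts (E d)) (l : ℕ) {f g : E d → ℂ}

theorem pSemi_nonneg (f : E d → ℂ) : 0 ≤ pSemi K l f :=
  Real.iSup_nonneg fun _ => norm_nonneg _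

theorem pSemi_bddAbove (hf : ContDiff ℝ ∞ f) :
    BddAbove (Set.range fun z : Fin (l + 1) × (K : Set (E d)) =>
      ‖iteratedFDeriv ℝ (z.1 : ℕ) f (z.2 : E d)‖) := by
  have : CompactSpace (K : Set (E d)) := isCompact_iff_compactSpace.1 K.isCompact
  refine (isCompact_range ?_).bddAbove
  refine continuous_prod_of_discrete_left.2 fun k => ?_
  exact ((hf.continuous_iteratedFDeriv (m := (k : ℕ)) (by exact_mod_cast le_top)).comp
    continuous_subtype_val).norm

theorem le_pSemi (hf : ContDiff ℝ ∞ f) {k : ℕ} (hk : k ≤ l) {x : E d} (hx : x ∈ K) :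
    ‖iteratedFDeriv ℝ k f x‖ ≤ pSemi K l f :=
  le_ciSup (pSemi_bddAbove K l hf) (⟨⟨k, Nat.lt_succ_of_le hk⟩, ⟨x, hx⟩⟩ :
    Fin (l + 1) × (K : Set (E d)))

theorem pSemi_le {C : ℝ} (hC : 0 ≤ C)
    (h : ∀ k ≤ l, ∀ x ∈ K, ‖iteratedFDeriv ℝ k f x‖ ≤ C) : pSemi K l f ≤ C :=
  Real.iSup_le (fun z => h z.1 (Nat.le_of_lt_succ z.1.2) z.2 z.2.2) hC

theorem pSemi_add (hf : ContDiff ℝ ∞ f) (hg : ContDiff ℝ ∞ g) :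
    pSemi K l (f + g) ≤ pSemi K l f + pSemi K l g := by
  refine pSemi_le K l (add_nonneg (pSemi_nonneg K l f) (pSemi_nonneg K l g)) fun k hk x hx => ?_
  have hk' : ((k : ℕ) : WithTop ℕ∞) ≤ ∞ := by exact_mod_cast le_top
  have : iteratedFDeriv ℝ k (f + g) x = iteratedFDeriv ℝ k f x + iteratedFDeriv ℝ k g x :=
    iteratedFDeriv_add_apply (hf.of_le hk').contDiffAt (hg.of_le hk').contDiffAt
  rw [this]
  exact (norm_add_le _ _).trans (add_le_add (le_pSemi K l hf hk hx) (le_pSemi K l hg hk hx))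

theorem pSemi_mul (hf : ContDiff ℝ ∞ f) (hg : ContDiff ℝ ∞ g) :
    pSemi K l (f * g) ≤ 2 ^ l * (pSemi K l f * pSemi K l g) := by
  have h0 := mul_nonneg (pSemi_nonneg K l f) (pSemi_nonneg K l g)
  refine pSemi_le K l (mul_nonneg (by positivity) h0) fun k hk x hx => ?_
  have hk' : ((k : ℕ) : WithTop ℕ∞) ≤ ∞ := by exact_mod_cast le_top
  calc ‖iteratedFDeriv ℝ k (f * g) x‖
      ≤ ∑ i ∈ Finset.range (k + 1), (k.choose i : ℝ) *
          ‖iteratedFDeriv ℝ i f x‖ * ‖iteratedFDeriv ℝ (k - i) g x‖ :=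
        norm_iteratedFDeriv_mul_le hf hg x hk'
    _ ≤ ∑ i ∈ Finset.range (k + 1), (k.choose i : ℝ) * (pSemi K l f * pSemi K l g) := by
        refine Finset.sum_le_sum fun i hi => ?_
        have hi' : i ≤ k := Nat.le_of_lt_succ (Finset.mem_range.1 hi)
        rw [mul_assoc]
        refine mul_le_mul_of_nonneg_left ?_ (Nat.cast_nonneg _)
        exact mul_le_mul (le_pSemi K l hf (hi'.trans hk) hx)
          (le_pSemi K l hg ((Nat.sub_le _ _).trans hk) hx) (norm_nonneg _) (pSemi_nonneg K l f)
    _ = 2 ^ k * (pSemi K l f * pSemi K l g) := by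
        rw [← Finset.sum_mul]
        congr 1
        exact_mod_cast Nat.sum_range_choose k
    _ ≤ 2 ^ l * (pSemi K l f * pSemi K l g) :=
        mul_le_mul_of_nonneg_right (pow_le_pow_right₀ (by norm_num) hk) h0

end pSemi

/-- Families of functions on `ℝ^d` indexed by `(0, 1]`. -/
abbrev Net (d : ℕ) : Type := I01 → E d → ℂ

/-- `(f_ε)_ε` is a net of smooth functions that is moderate. -/
def IsModerate {d : ℕ} (u : Net d) : Prop :=
  (∀ ε, ContDiff ℝ ∞ (u ε)) ∧
    ∀ (l : ℕ) (K : Compacts (E d)), ∃ q : ℕ,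
      (fun ε => pSemi K l (u ε)) =o[toZero] (fun ε : I01 => ((ε : ℝ) ^ q)⁻¹)

/-- `(f_ε)_ε` is a net of smooth functions that is negligible. -/
def IsNegligible {d : ℕ} (u : Net d) : Prop :=
  (∀ ε, ContDiff ℝ ∞ (u ε)) ∧
    ∀ (l : ℕ) (K : Compacts (E d)), ∀ p : ℕ,
      (fun ε => pSemi K l (u ε)) =o[toZero] (fun ε : I01 => (ε : ℝ) ^ p)

section closure

open Asymptotics

variable {d : ℕ}

theorem isLittleO_of_le {a b g : I01 → ℝ} (C : ℝ) (ha : ∀ ε, 0 ≤ a ε) (h : ∀ ε, a ε ≤ C * b ε)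
    (hb : b =o[toZero] g) : a =o[toZero] g := by
  refine IsBigO.trans_isLittleO ?_ hb
  refine IsBigO.of_bound |C| (Eventually.of_forall fun ε => ?_)
  rw [Real.norm_eq_abs, Real.norm_eq_abs, abs_of_nonneg (ha ε), ← abs_mul]
  exact (h ε).trans (le_abs_self _)

theorem isModerate_const {f : E d → ℂ} (hf : ContDiff ℝ ∞ f) : IsModerate (fun _ => f) := by
  refine ⟨fun _ => hf, fun l K => ⟨1, ?_⟩⟩
  have h : Tendsto (fun ε : I01 => (ε : ℝ)) toZero (𝓝 0) := tendsto_comap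
  rw [isLittleO_iff_tendsto']
  · simpa using h.const_mul (pSemi K l f)
  · exact Eventually.of_forall fun ε h0 => absurd h0 (by simpa using ε.2.1.ne')

theorem inv_pow_isBigO {q r : ℕ} (h : q ≤ r) :
    (fun ε : I01 => ((ε : ℝ) ^ q)⁻¹) =O[toZero] (fun ε : I01 => ((ε : ℝ) ^ r)⁻¹) := by
  refine IsBigO.of_bound 1 (Eventually.of_forall fun ε => ?_)
  have h0 := ε.2.1
  rw [one_mul, Real.norm_of_nonneg (by positivity), Real.norm_of_nonneg (by positivity)]
  exact inv_anti₀ (pow_pos h0 r) (pow_le_pow_of_le_one h0.le ε.2.2 h)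

theorem IsModerate.add {u v : Net d} (hu : IsModerate u) (hv : IsModerate v) :
    IsModerate (u + v) := by
  refine ⟨fun ε => (hu.1 ε).add (hv.1 ε), fun l K => ?_⟩
  obtain ⟨q, hq⟩ := hu.2 l K
  obtain ⟨r, hr⟩ := hv.2 l K
  refine ⟨max q r, isLittleO_of_le 1 (fun ε => pSemi_nonneg K l _) (fun ε => ?_)
    ((hq.trans_isBigO (inv_pow_isBigO (le_max_left q r))).add
      (hr.trans_isBigO (inv_pow_isBigO (le_max_right q r))))⟩
  rw [one_mul]
  exact pSemi_add K l (hu.1 ε) (hv.1 ε)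

theorem IsModerate.mul {u v : Net d} (hu : IsModerate u) (hv : IsModerate v) :
    IsModerate (u * v) := by
  refine ⟨fun ε => (hu.1 ε).mul (hv.1 ε), fun l K => ?_⟩
  obtain ⟨q, hq⟩ := hu.2 l K
  obtain ⟨r, hr⟩ := hv.2 l K
  refine ⟨q + r, isLittleO_of_le (2 ^ l) (fun ε => pSemi_nonneg K l _)
    (fun ε => pSemi_mul K l (hu.1 ε) (hv.1 ε)) ?_⟩
  refine (hq.mul hr).congr_right fun ε => ?_
  rw [pow_add, mul_inv]

theorem IsNegligible.add {u v : Net d} (hu : IsNegligible u) (hv : IsNegligible v) :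
    IsNegligible (u + v) := by
  refine ⟨fun ε => (hu.1 ε).add (hv.1 ε), fun l K p => ?_⟩
  refine isLittleO_of_le 1 (fun ε => pSemi_nonneg K l _) (fun ε => ?_)
    ((hu.2 l K p).add (hv.2 l K p))
  rw [one_mul]
  exact pSemi_add K l (hu.1 ε) (hv.1 ε)

theorem isNegligible_zero : IsNegligible (0 : Net d) := by
  refine ⟨fun _ => contDiff_const, fun l K p => ?_⟩
  have h : (fun ε => pSemi K l ((0 : Net d) ε)) = fun _ => (0 : ℝ) := by
    funext ε
    refine le_antisymm (pSemi_le K l le_rfl fun k _ x _ => ?_) (pSemi_nonneg K l _)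
    have h0 : (0 : Net d) ε = 0 := rfl
    rw [h0, iteratedFDeriv_zero]
    simp
  rw [h]
  exact isLittleO_zero _ _

theorem IsModerate.mul_isNegligible {u v : Net d} (hu : IsModerate u) (hv : IsNegligible v) :
    IsNegligible (u * v) := by
  refine ⟨fun ε => (hu.1 ε).mul (hv.1 ε), fun l K p => ?_⟩
  obtain ⟨q, hq⟩ := hu.2 l K
  refine isLittleO_of_le (2 ^ l) (fun ε => pSemi_nonneg K l _)
    (fun ε => pSemi_mul K l (hu.1 ε) (hv.1 ε)) ?_
  refine (hq.mul (hv.2 l K (q + p))).congr_right fun ε => ?_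
  have h0 : (ε : ℝ) ^ q ≠ 0 := pow_ne_zero _ ε.2.1.ne'
  rw [pow_add, inv_mul_cancel_left₀ h0]

end closure

/-- The algebra `F(C^∞(ℝ^d))` of moderate nets. -/
def Moderate (d : ℕ) : Subalgebra ℂ (Net d) where
  carrier := {u | IsModerate u}
  mul_mem' := IsModerate.mul
  add_mem' := IsModerate.add
  algebraMap_mem' := fun c => isModerate_const (f := fun _ => c) contDiff_const

/-- The ideal `N(C^∞(ℝ^d))` of negligible nets in the algebra of moderate nets. -/
def Negligible (d : ℕ) : Ideal (Moderate d) where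
  carrier := {u | IsNegligible (u : Net d)}
  add_mem' := IsNegligible.add
  zero_mem' := isNegligible_zero
  smul_mem' := fun u _ hv => IsModerate.mul_isNegligible u.2 hv

/-- Every negligible net is moderate, so that nothing is lost by taking `N` inside `F`. -/
theorem IsNegligible.isModerate {d : ℕ} {u : Net d} (hu : IsNegligible u) : IsModerate u :=
  ⟨hu.1, fun l K => ⟨0, by simpa using hu.2 l K 0⟩⟩

/-- The simplified Colombeau algebra `G(ℝ^d) = F(C^∞(ℝ^d)) / N(C^∞(ℝ^d))`. -/
abbrev G (d : ℕ) : Type := Moderate d ⧸ Negligible d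

/-- The class in `G(ℝ^d)` of a moderate net. -/
def G.mk {d : ℕ} (u : Net d) (hu : u ∈ Moderate d) : G d :=
  Ideal.Quotient.mk (Negligible d) ⟨u, hu⟩

/-- The constant embedding `σ : C^∞(ℝ^d) → G(ℝ^d)`, `f ↦ [(f)_ε]`. -/
def sigma {d : ℕ} (f : SmoothFun d) : G d :=
  G.mk (fun _ => (f : E d → ℂ)) (isModerate_const f.2)

/-- Complex valued test functions on `ℝ^d`. -/
abbrev Test (d : ℕ) : Type := 𝓓((⊤ : Opens (E d)), ℂ)

/-- The space `D'(ℝ^d)` of complex valued distributions: the continuous linear forms on the space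
of test functions. -/
abbrev Distr (d : ℕ) : Type := Test d →L[ℂ] ℂ

/-- The distribution `φ ↦ ∫ φ f` defined by a smooth function `f`. -/
def ofSmooth {d : ℕ} (f : SmoothFun d) : Distr d :=
  TestFunction.integralAgainstBilinCLM (ContinuousLinearMap.mul ℂ ℂ) volume (f : E d → ℂ)

theorem ofSmooth_apply {d : ℕ} (f : SmoothFun d) (φ : Test d) :
    ofSmooth f φ = ∫ x, φ x * (f : E d → ℂ) x := by
  have hf : ContDiff ℝ ∞ (f : E d → ℂ) := f.2
  exact TestFunction.integralAgainstBilinCLM_eq_integral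
    (hf.continuous.locallyIntegrable.locallyIntegrableOn _)

/-- The test function `x ↦ θ (y - x)`. -/
def reflect {d : ℕ} (θ : Test d) (y : E d) : Test d where
  toFun := fun x => θ (y - x)
  contDiff' := θ.contDiff.comp (contDiff_const.sub contDiff_id)
  hasCompactSupport' := θ.hasCompactSupport.comp_homeomorph (Homeomorph.subLeft y)
  tsupport_subset' := fun _ _ => trivial

/-- The convolution `(T ∗ θ)(y) = ⟨T, x ↦ θ (y - x)⟩`. -/
def conv {d : ℕ} (T : Distr d) (θ : Test d) (y : E d) : ℂ := T (reflect θ y)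

/-- The test function `θ_ε (x) = ε^(-d) ρ(x / ε) χ(x |ln ε|)`, for `0 < ε < 1`. -/
def theta {d : ℕ} (ρ : 𝓢(E d, ℂ)) (χ : 𝓓((⊤ : Opens (E d)), ℝ)) (ε : Set.Ioo (0 : ℝ) 1) :
    Test d where
  toFun := fun x =>
    (((ε : ℝ) ^ d)⁻¹ : ℝ) * ρ ((ε : ℝ)⁻¹ • x) * (χ (|Real.log ε| • x) : ℂ)
  contDiff' := by
    have h1 : ContDiff ℝ ∞ fun x : E d => ρ ((ε : ℝ)⁻¹ • x) :=
      (ρ.smooth ⊤).comp (contDiff_const_smul _)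
    have h2 : ContDiff ℝ ∞ fun x : E d => (χ (|Real.log ε| • x) : ℂ) :=
      Complex.ofRealCLM.contDiff.comp (χ.contDiff.comp (contDiff_const_smul _))
    exact (contDiff_const.mul h1).mul h2
  hasCompactSupport' := by
    have hc : |Real.log ε| ≠ 0 := abs_ne_zero.2 (Real.log_neg ε.2.1 ε.2.2).ne
    have h := χ.hasCompactSupport.comp_homeomorph (Homeomorph.smulOfNeZero (α := E d) _ hc)
    have h' : HasCompactSupport fun x : E d => (χ (|Real.log ε| • x) : ℂ) :=
      HasCompactSupport.comp_left (g := fun t : ℝ => (t : ℂ)) h Complex.ofReal_zero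
    exact h'.mul_left
  tsupport_subset' := fun _ _ => trivial

end Colombeau

end

noncomputable section

namespace Colombeau

open scoped BoundedContinuousFunction

/-! Everything rests on a local structure result and a Taylor estimate.

Structure (`exists_representation`): on test functions supported in a fixed compact set, continuity
of `T` and Hahn-Banach give `T φ = ∑ L_k (D^k φ)`, a finite sum with `L_k` bounded on bounded
continuous functions. Hence `T ∗ θ` is locally a sum of `L_k` applied to translates of reflected
derivatives of `θ`. Translation is smooth into the sup-norm space, with derivatives controlled by
those of `θ`, so `T ∗ θ` is smooth and its derivatives are bounded by sup norms of derivatives of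
`θ`. For `θ_ε` these grow at most like a power of `1/ε`, which is moderateness.

Taylor estimate (`exists_norm_integral_sub_le`): in `∫ θ_ε(x) G(y - x) dx` substitute `x = ε z` and
expand `G` to degree `n`. The moments of `ρ` leave only `G y`, and the remainder is `O(ε^(n+1))`.
The cut-off matters only where `|ln ε| ε ‖z‖ > 1`, and there the decay of `ρ` yields any power of
`ε`. Applied to the derivatives of a smooth `f`, this gives `ι f = σ f`.

Injectivity: moving the integral through the `L_k` turns `∫ φ (T ∗ θ_ε)` into `L_k` of mollified
derivatives of `φ`. These converge uniformly by the same estimate, so the integral tends to `T φ`.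
If the net is negligible it also tends to `0`. -/

theorem norm_iteratedFDeriv_iteratedFDeriv {E F : Type*} [NormedAddCommGroup E] [NormedSpace ℝ E]
    [NormedAddCommGroup F] [NormedSpace ℝ F] (f : E → F) (x : E) (n k : ℕ) :
    ‖iteratedFDeriv ℝ n (iteratedFDeriv ℝ k f) x‖ = ‖iteratedFDeriv ℝ (n + k) f x‖ := by
  induction k generalizing n with
  | zero =>
    rw [iteratedFDeriv_zero_eq_comp, LinearIsometryEquiv.norm_iteratedFDeriv_comp_left, add_zero]
  | succ k ih =>
    let I : (E →L[ℝ] E [×k]→L[ℝ] F) ≃ₗᵢ[ℝ] (E [×(k + 1)]→L[ℝ] F) :=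
      (continuousMultilinearCurryLeftEquiv ℝ (fun _ : Fin (k + 1) => E) F).symm
    have hI : iteratedFDeriv ℝ (k + 1) f = I ∘ fderiv ℝ (iteratedFDeriv ℝ k f) :=
      iteratedFDeriv_succ_eq_comp_left
    have hn := LinearIsometryEquiv.norm_iteratedFDeriv_comp_left (𝕜 := ℝ) (E := E)
      (F := E →L[ℝ] E [×k]→L[ℝ] F)
      (G := E [×(k + 1)]→L[ℝ] F) I (fderiv ℝ (iteratedFDeriv ℝ k f)) x n
    rw [hI, hn, norm_iteratedFDeriv_fderiv, ih, add_assoc, add_comm 1 k]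

/-! ### Bounded continuous functions with the sup norm -/

section BCF

variable {d : ℕ} {W : Type} [NormedAddCommGroup W]

variable (d W) in
/-- The bounded continuous functions on `ℝ^d`, as a normed space only. -/
def BCF : Type := E d →ᵇ W

instance : NormedAddCommGroup (BCF d W) := inferInstanceAs (NormedAddCommGroup (E d →ᵇ W))

instance {𝕜 : Type*} [NormedField 𝕜] [NormedSpace 𝕜 W] : NormedSpace 𝕜 (BCF d W) :=
  inferInstanceAs (NormedSpace 𝕜 (E d →ᵇ W))

instance [NormedSpace ℝ W] [NormedSpace ℂ W] [IsScalarTower ℝ ℂ W] :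
    IsScalarTower ℝ ℂ (BCF d W) :=
  inferInstanceAs (IsScalarTower ℝ ℂ (E d →ᵇ W))

instance [CompleteSpace W] : CompleteSpace (BCF d W) :=
  inferInstanceAs (CompleteSpace (E d →ᵇ W))

instance : FunLike (BCF d W) (E d) W := inferInstanceAs (FunLike (E d →ᵇ W) (E d) W)

namespace BCF

theorem ext {f g : BCF d W} (h : ∀ x, f x = g x) : f = g := DFunLike.ext _ _ h

theorem norm_le {f : BCF d W} {C : ℝ} (hC : 0 ≤ C) : ‖f‖ ≤ C ↔ ∀ x, ‖f x‖ ≤ C :=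
  BoundedContinuousFunction.norm_le hC

theorem norm_coe_le_norm (f : BCF d W) (x : E d) : ‖f x‖ ≤ ‖f‖ :=
  BoundedContinuousFunction.norm_coe_le_norm f x

protected theorem continuous (f : BCF d W) : Continuous f :=
  BoundedContinuousFunction.continuous f

@[simp]
theorem sub_apply (f g : BCF d W) (x : E d) : (f - g) x = f x - g x := rfl

/-- A bounded continuous function given by its values. -/
def mk (f : E d → W) (hf : Continuous f) (C : ℝ) (h : ∀ x, ‖f x‖ ≤ C) : BCF d W :=
  BoundedContinuousFunction.ofNormedAddCommGroup f hf C h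

/-- Evaluation at a point. -/
def eval (𝕜 : Type*) [NontriviallyNormedField 𝕜] [NormedSpace 𝕜 W] (x : E d) :
    BCF d W →L[𝕜] W :=
  LinearMap.mkContinuous ⟨⟨fun f => f x, fun _ _ => rfl⟩, fun _ _ => rfl⟩ 1
    fun f => (norm_coe_le_norm f x).trans (one_mul _).ge

@[simp]
theorem eval_apply (𝕜 : Type*) [NontriviallyNormedField 𝕜] [NormedSpace 𝕜 W] (x : E d)
    (f : BCF d W) : eval 𝕜 x f = f x := rfl

end BCF

end BCF

/-! ### Smoothness of translation into the sup-norm space -/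

section shift

variable {d : ℕ} {W : Type} [NormedAddCommGroup W] [NormedSpace ℝ W]

/-- A test function as a bounded continuous function. -/
def toBCF (g : 𝓓((⊤ : Opens (E d)), W)) : BCF d W := (g : E d →ᵇ W)

@[simp]
theorem toBCF_apply (g : 𝓓((⊤ : Opens (E d)), W)) (x : E d) : toBCF g x = g x := rfl

/-- The translate `x ↦ g (y - x)` as a bounded continuous function. -/
def shift (g : 𝓓((⊤ : Opens (E d)), W)) (y : E d) : BCF d W :=
  (g : E d →ᵇ W).compContinuous ⟨fun x => y - x, by fun_prop⟩

@[simp]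
theorem shift_apply (g : 𝓓((⊤ : Opens (E d)), W)) (y x : E d) : shift g y x = g (y - x) := rfl

variable (d W) in
/-- Evaluation of a family of linear maps at a vector. -/
def evalBCF : BCF d (E d →L[ℝ] W) →L[ℝ] E d →L[ℝ] BCF d W :=
  LinearMap.mkContinuous₂
    (LinearMap.mk₂ ℝ
      (fun (b : BCF d (E d →L[ℝ] W)) (v : E d) => BCF.mk (fun x => b x v)
        (b.continuous.clm_apply continuous_const) (‖b‖ * ‖v‖)
        (fun x => (b x).le_of_opNorm_le (b.norm_coe_le_norm x) v))
      (fun _ _ _ => rfl) (fun _ _ _ => rfl)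
      (fun b v w => BCF.ext fun x => map_add (b x) v w)
      (fun c b v => BCF.ext fun x => map_smul (b x) c v)) 1
    (fun b v => by
      rw [one_mul]
      exact (BCF.norm_le (by positivity)).2
        fun x => (b x).le_of_opNorm_le (b.norm_coe_le_norm x) v)

@[simp]
theorem evalBCF_apply (b : BCF d (E d →L[ℝ] W)) (v x : E d) : evalBCF d W b v x = b x v := rfl

theorem norm_evalBCF_le : ‖evalBCF d W‖ ≤ 1 :=
  LinearMap.mkContinuous₂_norm_le _ zero_le_one _

/-- The derivative of a vector valued test function. -/
def fderivTest (g : 𝓓((⊤ : Opens (E d)), W)) : 𝓓((⊤ : Opens (E d)), E d →L[ℝ] W) :=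
  ⟨fderiv ℝ g, g.contDiff.fderiv_right (by simp), g.hasCompactSupport.fderiv ℝ,
    fun _ _ => trivial⟩

@[simp]
theorem coe_fderivTest (g : 𝓓((⊤ : Opens (E d)), W)) : ⇑(fderivTest g) = fderiv ℝ g := rfl

/-- Compact support makes `Dg` globally Lipschitz, so the mean value inequality bounds the
first-order error by `C ‖h‖ ^ 2` uniformly in the point `x`, that is, in the sup norm. -/
theorem hasFDerivAt_shift (g : 𝓓((⊤ : Opens (E d)), W)) (y : E d) :
    HasFDerivAt (shift g) (evalBCF d W (shift (fderivTest g) y)) y := by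
  obtain ⟨C, hC⟩ := ContDiff.lipschitzWith_of_hasCompactSupport (fderivTest g).hasCompactSupport
    (fderivTest g).contDiff (by simp)
  rw [hasFDerivAt_iff_isLittleO_nhds_zero]
  refine Asymptotics.IsBigO.trans_isLittleO (g := fun h : E d => ‖h‖ ^ 2) ?_ ?_
  · refine Asymptotics.IsBigO.of_bound C (Eventually.of_forall fun h => ?_)
    rw [BCF.norm_le (by positivity)]
    intro x
    have key := (convex_closedBall (y - x) ‖h‖).norm_image_sub_le_of_norm_fderiv_le'
      (f := g) (φ := fderiv ℝ g (y - x)) (C := C * ‖h‖) (x := y - x) (y := y - x + h)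
      (fun z _ => (g.contDiff.differentiable (by simp)).differentiableAt)
      (fun z hz => by
        have := hC.dist_le_mul z (y - x)
        rw [dist_eq_norm, coe_fderivTest] at this
        exact this.trans (mul_le_mul_of_nonneg_left (Metric.mem_closedBall.1 hz) C.2))
      (Metric.mem_closedBall_self (norm_nonneg h)) (by simp [dist_eq_norm])
    rw [add_sub_cancel_left] at key
    simp only [BCF.sub_apply, shift_apply, evalBCF_apply,
      coe_fderivTest]
    rw [Real.norm_of_nonneg (by positivity), sq, ← mul_assoc, add_sub_right_comm]
    exact key
  · simpa using (Asymptotics.isLittleO_norm_pow_id (E' := E d) one_lt_two)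

/-- The derivative of a shift is a fixed continuous linear map applied to the shift of `Dg`. The
induction changes the target space, hence `W` is quantified after `n`. -/
theorem contDiff_shift_nat (n : ℕ) : ∀ {W : Type} [NormedAddCommGroup W] [NormedSpace ℝ W]
    (g : 𝓓((⊤ : Opens (E d)), W)), ContDiff ℝ n (shift g) := by
  induction n with
  | zero =>
    intro W _ _ g
    exact contDiff_zero.2 (continuous_iff_continuousAt.2 fun y =>
      (hasFDerivAt_shift g y).continuousAt)
  | succ n ih =>
    intro W _ _ g
    refine contDiff_succ_iff_hasFDerivAt.2 ⟨_, ?_, hasFDerivAt_shift g⟩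
    exact (evalBCF d W).contDiff.comp (ih (fderivTest g))

theorem contDiff_shift (g : 𝓓((⊤ : Opens (E d)), W)) : ContDiff ℝ ∞ (shift g) :=
  contDiff_infty.2 fun n => contDiff_shift_nat n g

theorem norm_iteratedFDeriv_shift_le (n : ℕ) : ∀ {W : Type} [NormedAddCommGroup W]
    [NormedSpace ℝ W] (g : 𝓓((⊤ : Opens (E d)), W)) {M : ℝ}, 0 ≤ M →
    (∀ x, ‖iteratedFDeriv ℝ n g x‖ ≤ M) → ∀ y, ‖iteratedFDeriv ℝ n (shift g) y‖ ≤ M := by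
  induction n with
  | zero =>
    intro W _ _ g M hM h y
    rw [norm_iteratedFDeriv_zero, BCF.norm_le hM]
    intro x
    simpa using h (y - x)
  | succ n ih =>
    intro W _ _ g M hM h y
    have hd : fderiv ℝ (shift g) = evalBCF d W ∘ shift (fderivTest g) :=
      funext fun y => (hasFDerivAt_shift g y).fderiv
    rw [← norm_iteratedFDeriv_fderiv, hd]
    refine ((evalBCF d W).norm_iteratedFDeriv_comp_left
      (contDiff_shift (fderivTest g)).contDiffAt (by exact_mod_cast le_top)).trans ?_
    refine (mul_le_of_le_one_left (norm_nonneg _) norm_evalBCF_le).trans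
      (ih (fderivTest g) hM (fun x => ?_) y)
    rw [coe_fderivTest, norm_iteratedFDeriv_fderiv]
    exact h x

end shift

/-! ### Local structure of distributions, and the convolution `T ∗ θ` -/

section representation

variable {d : ℕ}

/-- The derivative of order `k` of a test function. -/
def jet (k : ℕ) (φ : Test d) : 𝓓((⊤ : Opens (E d)), E d [×k]→L[ℝ] ℂ) :=
  ⟨iteratedFDeriv ℝ k φ, φ.contDiff.iteratedFDeriv_right (by norm_cast),
    φ.hasCompactSupport.iteratedFDeriv k, fun _ _ => trivial⟩

@[simp]
theorem coe_jet (k : ℕ) (φ : Test d) : ⇑(jet k φ) = iteratedFDeriv ℝ k φ := rfl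

/-- The bound makes `T` vanish on `ker j`, so it descends to a bounded form on the range of `j`,
which Hahn-Banach extends to `B`. -/
theorem exists_extension_of_norm_le {V B : Type*} [AddCommGroup V] [Module ℂ V]
    [NormedAddCommGroup B] [NormedSpace ℂ B] (j : V →ₗ[ℂ] B) (T : V →ₗ[ℂ] ℂ) (C : ℝ)
    (h : ∀ v, ‖T v‖ ≤ C * ‖j v‖) : ∃ L : B →L[ℂ] ℂ, ∀ v, T v = L (j v) := by
  have hker : LinearMap.ker j ≤ LinearMap.ker T := fun v hv => by
    have h1 := h v
    rw [LinearMap.mem_ker.1 hv, norm_zero, mul_zero] at h1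
    exact norm_le_zero_iff.1 h1
  let S : LinearMap.range j →ₗ[ℂ] ℂ :=
    (LinearMap.ker j).liftQ T hker ∘ₗ j.quotKerEquivRange.symm.toLinearMap
  have hS : ∀ v, S ⟨j v, v, rfl⟩ = T v := fun v => by
    have : j.quotKerEquivRange.symm ⟨j v, v, rfl⟩ = (LinearMap.ker j).mkQ v :=
      j.quotKerEquivRange_symm_apply_image v _
    simp only [S, LinearMap.comp_apply, LinearEquiv.coe_coe, this]
    rfl
  obtain ⟨L, hL, -⟩ := exists_extension_norm_eq (LinearMap.range j) (S.mkContinuous C (by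
    rintro ⟨_, v, rfl⟩
    rw [hS]
    exact h v))
  exact ⟨L, fun v => ((hL ⟨j v, v, rfl⟩).trans (hS v)).symm⟩

/-- On the test functions supported in a fixed compact set, a distribution is a finite sum of
continuous linear forms of the derivatives in the uniform norm. -/
theorem exists_representation (T : Distr d) (K : Compacts (E d)) :
    ∃ (N : ℕ) (L : ∀ k : ℕ, BCF d (E d [×k]→L[ℝ] ℂ) →L[ℂ] ℂ), ∀ φ : Test d,
      Function.support φ ⊆ K →
        T φ = ∑ k ∈ Finset.range N, L k (toBCF (jet k φ)) := by
  classical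
  let ι := TestFunction.ofSupportedInCLM (F := ℂ) (n := ⊤) ℂ (K := K) (Ω := ⊤)
    fun _ _ => trivial
  have hcont : Continuous ((normSeminorm ℂ ℂ).comp (T ∘L ι).toLinearMap) :=
    continuous_norm.comp (T ∘L ι).continuous
  -- Continuity on test functions supported in `K` involves only finitely many derivative norms.
  -- They embed this space in the finite product `B`.
  obtain ⟨s, C, -, hC⟩ := Seminorm.bound_of_continuous
    (ContDiffMapSupportedIn.withSeminorms ℂ (E d) ℂ ⊤ K) _ hcont
  obtain ⟨N, hN⟩ : ∃ N, s ⊆ Finset.range N := s.exists_nat_subset_range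
  let B := ∀ k : Fin N, BCF d (E d [×(k : ℕ)]→L[ℝ] ℂ)
  let j : 𝓓_{K}(E d, ℂ) →ₗ[ℂ] B :=
    { toFun := fun f k => ContDiffMapSupportedIn.structureMapLM ℂ ⊤ k f
      map_add' := fun f g => funext fun k =>
        map_add (ContDiffMapSupportedIn.structureMapLM ℂ ⊤ (k : ℕ)) f g
      map_smul' := fun c f => funext fun k =>
        map_smul (ContDiffMapSupportedIn.structureMapLM ℂ ⊤ (k : ℕ)) c f }
  obtain ⟨L, hL⟩ := exists_extension_of_norm_le j (T ∘L ι).toLinearMap C (fun φ => by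
    refine (hC φ).trans (mul_le_mul_of_nonneg_left ?_ C.2)
    refine Seminorm.finset_sup_apply_le (norm_nonneg _) fun k hk => ?_
    exact norm_le_pi_norm (j φ) ⟨k, Finset.mem_range.1 (hN hk)⟩)
  -- `L_k` is the restriction of the form to the `k`-th factor, padded by `0` for `k ≥ N`.
  refine ⟨N, fun k => if h : k < N then L ∘L ContinuousLinearMap.single ℂ
    (fun k : Fin N => BCF d (E d [×(k : ℕ)]→L[ℝ] ℂ)) ⟨k, h⟩ else 0, fun φ hφ => ?_⟩
  let φK : 𝓓_{K}(E d, ℂ) := .of_support_subset φ.contDiff hφ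
  have h1 : T φ = L (j φK) := hL φK
  have h2 : j φK = ∑ k : Fin N, Pi.single k (toBCF (jet k φ)) := by
    rw [Finset.univ_sum_single (f := fun k : Fin N =>
      (toBCF (jet k φ)))]
    funext k
    refine BCF.ext fun x => ?_
    exact congrFun (ContDiffMapSupportedIn.structureMapLM_top_apply ℂ φK) x
  rw [h1, h2, map_sum, Finset.sum_range]
  refine Finset.sum_congr rfl fun k _ => ?_
  beta_reduce
  rw [dif_pos k.2]
  rfl

theorem iteratedFDeriv_comp_sub_left {W : Type*} [NormedAddCommGroup W] [NormedSpace ℝ W]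
    {g : E d → W} (hg : ContDiff ℝ ∞ g) (k : ℕ) (y x : E d) :
    iteratedFDeriv ℝ k (fun x => g (y - x)) x = (-1 : ℝ) ^ k • iteratedFDeriv ℝ k g (y - x) := by
  have h := congrFun (iteratedFDeriv_comp_const_smul (𝕜 := ℝ) (i := k) (-1)
    (f := fun z => g (y + z)) ((hg.of_le (by exact_mod_cast le_top)).comp (by fun_prop))) x
  simp only [iteratedFDeriv_comp_add_left] at h
  simpa [sub_eq_add_neg] using h

theorem jet_reflect (k : ℕ) (θ : Test d) (y : E d) :
    toBCF (jet k (reflect θ y)) = shift ((-1 : ℝ) ^ k • jet k θ) y := by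
  refine BCF.ext fun x => ?_
  exact iteratedFDeriv_comp_sub_left θ.contDiff k y x

theorem support_reflect_subset {θ : Test d} {r R : ℝ} (hθ : ∀ x, r ≤ ‖x‖ → θ x = 0) {y : E d}
    (hy : ‖y‖ ≤ R) : Function.support (reflect θ y) ⊆ Metric.closedBall 0 (R + r) := by
  intro x hx
  by_contra hx'
  refine hx (hθ (y - x) ?_)
  rw [mem_closedBall_zero_iff, not_le] at hx'
  have := norm_sub_norm_le x y
  rw [norm_sub_rev] at this
  linarith

/-- The closed ball of radius `R` around the origin. -/
def cball (d : ℕ) (R : ℝ) : Compacts (E d) := ⟨Metric.closedBall 0 R, isCompact_closedBall 0 R⟩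

/-- For `‖y‖ ≤ R` and `θ` vanishing outside radius `r`, all the functions `θ (y - ·)` live in the
ball of radius `R + r`, so one representation serves them all. Injectivity needs the same `L` for `T
φ` itself. -/
theorem exists_conv_eq_sum (T : Distr d) (R r : ℝ) :
    ∃ (N : ℕ) (L : ∀ k : ℕ, BCF d (E d [×k]→L[ℝ] ℂ) →L[ℂ] ℂ),
      (∀ θ : Test d, (∀ x, r ≤ ‖x‖ → θ x = 0) → ∀ y, ‖y‖ ≤ R →
        conv T θ y = ∑ k ∈ Finset.range N, L k (shift ((-1 : ℝ) ^ k • jet k θ) y)) ∧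
      ∀ φ : Test d, Function.support φ ⊆ Metric.closedBall 0 (R + r) →
        T φ = ∑ k ∈ Finset.range N, L k (toBCF (jet k φ)) := by
  obtain ⟨N, L, hL⟩ := exists_representation T (cball d (R + r))
  refine ⟨N, L, fun θ hθ y hy => ?_, hL⟩
  rw [conv, hL _ (support_reflect_subset hθ hy)]
  simp_rw [jet_reflect]

theorem exists_forall_eq_zero (θ : Test d) : ∃ r, ∀ x, r ≤ ‖x‖ → θ x = 0 := by
  obtain ⟨r, hr⟩ := θ.hasCompactSupport.isCompact.isBounded.subset_ball 0
  refine ⟨r, fun x hx => image_eq_zero_of_notMem_tsupport fun h => ?_⟩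
  exact absurd (mem_ball_zero_iff.1 (hr h)) (not_lt.2 hx)

theorem contDiff_comp_shift (L : ∀ k : ℕ, BCF d (E d [×k]→L[ℝ] ℂ) →L[ℂ] ℂ)
    (g : ∀ k : ℕ, 𝓓((⊤ : Opens (E d)), E d [×k]→L[ℝ] ℂ)) (k : ℕ) :
    ContDiff ℝ ∞ ((L k).restrictScalars ℝ ∘ shift (g k)) :=
  ((L k).restrictScalars ℝ).contDiff.comp (contDiff_shift (g k))

theorem contDiff_conv (T : Distr d) (θ : Test d) : ContDiff ℝ ∞ (conv T θ) := by
  rw [contDiff_iff_contDiffAt]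
  intro y
  obtain ⟨r, hr⟩ := exists_forall_eq_zero θ
  obtain ⟨N, L, h, -⟩ := exists_conv_eq_sum T (‖y‖ + 1) r
  have hsm : ContDiff ℝ ∞ fun y => ∑ k ∈ Finset.range N,
      ((L k).restrictScalars ℝ ∘ shift ((-1 : ℝ) ^ k • jet k θ)) y :=
    ContDiff.sum fun k _ => contDiff_comp_shift L (fun k => (-1 : ℝ) ^ k • jet k θ) k
  refine hsm.contDiffAt.congr_of_eventuallyEq ?_
  have : ∀ᶠ z in 𝓝 y, ‖z‖ < ‖y‖ + 1 :=
    continuous_norm.continuousAt.eventually_lt continuousAt_const (lt_add_one _)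
  filter_upwards [this] with z hz
  exact h θ hr z hz.le

/-- `N` and `C` precede `θ`, so they are uniform along `θ_ε`. The orders up to `N + n` come from
fewer than `N` derivatives seen by the `L_k` and `n` from differentiating in `y`. -/
theorem exists_norm_iteratedFDeriv_conv_le (T : Distr d) (R r : ℝ) :
    ∃ (N : ℕ) (C : ℝ), 0 ≤ C ∧ ∀ θ : Test d, (∀ x, r ≤ ‖x‖ → θ x = 0) →
      ∀ (n : ℕ) (M : ℝ), 0 ≤ M → (∀ k ≤ N + n, ∀ x, ‖iteratedFDeriv ℝ k θ x‖ ≤ M) →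
        ∀ y, ‖y‖ < R → ‖iteratedFDeriv ℝ n (conv T θ) y‖ ≤ C * M := by
  obtain ⟨N, L, h, -⟩ := exists_conv_eq_sum T R r
  refine ⟨N, ∑ k ∈ Finset.range N, ‖(L k).restrictScalars ℝ‖, by positivity,
    fun θ hθ n M hM hb y hy => ?_⟩
  have heq : conv T θ =ᶠ[𝓝 y] fun y => ∑ k ∈ Finset.range N,
      ((L k).restrictScalars ℝ ∘ shift ((-1 : ℝ) ^ k • jet k θ)) y := by
    have : ∀ᶠ z in 𝓝 y, ‖z‖ < R :=
      continuous_norm.continuousAt.eventually_lt continuousAt_const hy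
    filter_upwards [this] with z hz
    exact h θ hθ z hz.le
  have hn : (n : WithTop ℕ∞) ≤ ∞ := by exact_mod_cast le_top
  rw [heq.iteratedFDeriv ℝ n |>.eq_of_nhds, iteratedFDeriv_sum fun k _ =>
    (contDiff_comp_shift L (fun k => (-1 : ℝ) ^ k • jet k θ) k).of_le hn, Finset.sum_apply, Finset.sum_mul]
  refine (norm_sum_le _ _).trans (Finset.sum_le_sum fun k hk => ?_)
  refine (((L k).restrictScalars ℝ).norm_iteratedFDeriv_comp_left
    (contDiff_shift _).contDiffAt hn).trans (mul_le_mul_of_nonneg_left ?_ (norm_nonneg _))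
  refine norm_iteratedFDeriv_shift_le n _ hM (fun x => ?_) y
  have h1 : ⇑((-1 : ℝ) ^ k • jet k θ) = (-1 : ℝ) ^ k • ⇑(jet k θ) := rfl
  rw [h1, iteratedFDeriv_const_smul_apply ((jet k θ).contDiff.of_le hn).contDiffAt, norm_smul,
    coe_jet, norm_iteratedFDeriv_iteratedFDeriv]
  simpa using hb (n + k) (by have := Finset.mem_range.1 hk; omega) x

end representation

/-! ### Differentiation under the convolution integral -/

section integral

theorem integrable_smul_sub {d : ℕ} {W : Type} [NormedAddCommGroup W] [NormedSpace ℂ W]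
    {w : E d → ℂ} (hw : Continuous w) (hc : HasCompactSupport w)
    {G : E d → W} (hG : Continuous G) (y : E d) : Integrable fun x => w x • G (y - x) :=
  (hw.smul (hG.comp (by fun_prop))).integrable_of_hasCompactSupport hc.smul_right

variable {d : ℕ} {W : Type} [NormedAddCommGroup W] [NormedSpace ℝ W] [NormedSpace ℂ W]
  [SMulCommClass ℝ ℂ W]

theorem hasFDerivAt_integral_smul_sub {w : E d → ℂ} (hw : Continuous w)
    (hc : HasCompactSupport w) {G : E d → W} (hG : ContDiff ℝ ∞ G) (y : E d) :
    HasFDerivAt (fun y => ∫ x, w x • G (y - x)) (∫ x, w x • fderiv ℝ G (y - x)) y := by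
  have hG' : Continuous (fderiv ℝ G) := hG.continuous_fderiv (by simp)
  -- For `z` near `y` and `x` in the support of `w`, the points `z - x` stay in this compact set. A
  -- bound `M` of `DG` there gives the dominating function `‖w‖ * M`.
  have hK : IsCompact ((fun p : E d × E d => p.1 - p.2) ''
      (Metric.closedBall y 1 ×ˢ tsupport w)) :=
    ((isCompact_closedBall y 1).prod hc.isCompact).image (by fun_prop)
  obtain ⟨M, hM⟩ := hK.exists_bound_of_continuousOn
    hG'.continuousOn
  refine hasFDerivAt_integral_of_dominated_of_fderiv_le (𝕜 := ℝ) (s := Metric.ball y 1)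
    (F := fun y x => w x • G (y - x)) (F' := fun y x => w x • fderiv ℝ G (y - x))
    (bound := fun x => ‖w x‖ * M)
    (Metric.ball_mem_nhds y one_pos)
    (Eventually.of_forall fun z =>
      (integrable_smul_sub hw hc hG.continuous z).aestronglyMeasurable)
    (integrable_smul_sub hw hc hG.continuous y)
    (integrable_smul_sub hw hc hG' y).aestronglyMeasurable
    (Eventually.of_forall fun x z hz => ?_)
    ((hw.norm.integrable_of_hasCompactSupport hc.norm).mul_const M)
    (Eventually.of_forall fun x z _ => ?_)
  · rw [norm_smul]
    by_cases hx : x ∈ tsupport w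
    · exact mul_le_mul_of_nonneg_left
        (hM _ ⟨(z, x), ⟨Metric.ball_subset_closedBall hz, hx⟩, rfl⟩) (norm_nonneg _)
    · simp [image_eq_zero_of_notMem_tsupport hx]
  · have h1 : HasFDerivAt G (fderiv ℝ G (z - x)) (z - x) :=
      ((hG.differentiable (by simp)) (z - x)).hasFDerivAt
    have h2 : HasFDerivAt (fun z => G (z - x)) (fderiv ℝ G (z - x)) z :=
      h1.comp z ((hasFDerivAt_id z).sub_const x)
    exact h2.const_smul (w x)

theorem iteratedFDeriv_integral_smul_sub {w : E d → ℂ} (hw : Continuous w)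
    (hc : HasCompactSupport w) {G : E d → W} (hG : ContDiff ℝ ∞ G) (k : ℕ) :
    iteratedFDeriv ℝ k (fun y => ∫ x, w x • G (y - x)) =
      fun y => ∫ x, w x • iteratedFDeriv ℝ k G (y - x) := by
  induction k with
  | zero =>
    funext y
    ext m
    let I : W ≃ₗᵢ[ℝ] (E d [×0]→L[ℝ] W) := (continuousMultilinearCurryFin0 ℝ (E d) W).symm
    exact congrFun (congrArg DFunLike.coe (I.toContinuousLinearEquiv.integral_comp_comm
      (μ := volume) (fun x => w x • G (y - x)))) m |>.symm
  | succ k ih =>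
    let I : (E d →L[ℝ] E d [×k]→L[ℝ] W) ≃ₗᵢ[ℝ] (E d [×(k + 1)]→L[ℝ] W) :=
      (continuousMultilinearCurryLeftEquiv ℝ (fun _ : Fin (k + 1) => E d) W).symm
    have hI : ∀ f : E d → W, iteratedFDeriv ℝ (k + 1) f = I ∘ fderiv ℝ (iteratedFDeriv ℝ k f) :=
      fun f => iteratedFDeriv_succ_eq_comp_left
    funext y
    rw [hI, ih, Function.comp_apply, (hasFDerivAt_integral_smul_sub hw hc
      (hG.iteratedFDeriv_right (by norm_cast)) y).fderiv, hI]
    exact (ContinuousLinearEquiv.integral_comp_comm (𝕜 := ℝ) (E := E d →L[ℝ] E d [×k]→L[ℝ] W)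
      (F := E d [×(k + 1)]→L[ℝ] W) (μ := volume) I.toContinuousLinearEquiv
      (fun x => w x • fderiv ℝ (iteratedFDeriv ℝ k G) (y - x))).symm

end integral

/-! ### Taylor polynomials and their remainder -/

section taylor

variable {d : ℕ} {W : Type} [NormedAddCommGroup W] [NormedSpace ℝ W]

theorem diag_eq_sum {n : ℕ} (A : E d [×n]→L[ℝ] W) (z : E d) :
    (A fun _ => z) = ∑ f : Fin n → Fin d,
      (∏ j, z (f j)) • A fun j => EuclideanSpace.single (f j) (1 : ℝ) := by
  have hz : z = ∑ i, z i • EuclideanSpace.single i (1 : ℝ) := by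
    ext j
    simp [Finset.sum_apply, Pi.single_apply]
  conv_lhs => rw [hz]
  rw [A.map_sum]
  exact Finset.sum_congr rfl fun f _ => A.map_smul_univ _ _

/-- The Taylor polynomial of degree `n`, as a function of the increment. -/
def taylorPoly (G : E d → W) (y : E d) (n : ℕ) (x : E d) : W :=
  ∑ k ∈ Finset.range (n + 1), ((k.factorial : ℝ)⁻¹) • iteratedFDeriv ℝ k G y fun _ => x

theorem norm_taylorPoly_le {G : E d → W} {y : E d} {n : ℕ} {M : ℝ}
    (h : ∀ k ≤ n, ‖iteratedFDeriv ℝ k G y‖ ≤ M) (x : E d) :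
    ‖taylorPoly G y n x‖ ≤ (n + 1) * M * (1 + ‖x‖) ^ n := by
  have hM : 0 ≤ M := (norm_nonneg _).trans (h 0 n.zero_le)
  have : ∀ k ∈ Finset.range (n + 1),
      ‖((k.factorial : ℝ)⁻¹) • iteratedFDeriv ℝ k G y fun _ => x‖ ≤ M * (1 + ‖x‖) ^ n := by
    intro k hk
    have hk : k ≤ n := Nat.le_of_lt_succ (Finset.mem_range.1 hk)
    rw [norm_smul]
    have h1 : ‖((k.factorial : ℝ)⁻¹)‖ ≤ 1 := by
      rw [norm_inv, Real.norm_natCast]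
      exact inv_le_one_of_one_le₀ (by exact_mod_cast k.factorial_pos)
    have h2 : ‖iteratedFDeriv ℝ k G y fun _ => x‖ ≤ M * ‖x‖ ^ k := by
      have := (iteratedFDeriv ℝ k G y).le_of_opNorm_le (h k hk) fun _ => x
      simpa using this
    calc _ ≤ 1 * (M * ‖x‖ ^ k) := mul_le_mul h1 h2 (norm_nonneg _) zero_le_one
      _ ≤ M * (1 + ‖x‖) ^ n := by
        rw [one_mul]
        refine mul_le_mul_of_nonneg_left ?_ hM
        exact (pow_le_pow_left₀ (norm_nonneg x) (by linarith) k).trans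
          (pow_le_pow_right₀ (by linarith [norm_nonneg x]) hk)
  refine (norm_sum_le_of_le _ this).trans ?_
  simp [mul_assoc]

theorem norm_sub_taylorPoly_le [CompleteSpace W] {G : E d → W} (hG : ContDiff ℝ ∞ G) {y : E d}
    {n : ℕ} {M r : ℝ} (h : ∀ x, ‖x‖ ≤ r → ‖iteratedFDeriv ℝ (n + 1) G (y - x)‖ ≤ M) {x : E d}
    (hx : ‖x‖ ≤ r) : ‖G (y - x) - taylorPoly G y n (-x)‖ ≤ M * ‖x‖ ^ (n + 1) := by
  have hM : 0 ≤ M := (norm_nonneg _).trans (h x hx)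
  have hT := map_add_eq_sum_add_integral_iteratedFDeriv (f := G) (x := y) (y := -x) (n := n)
    fun t _ => (hG.of_le (by exact_mod_cast le_top)).contDiffAt
  rw [sub_eq_add_neg y x, hT, taylorPoly, add_sub_cancel_left, norm_smul]
  have h1 : ‖((n.factorial : ℝ)⁻¹)‖ ≤ 1 := by
    rw [norm_inv, Real.norm_natCast]
    exact inv_le_one_of_one_le₀ (by exact_mod_cast n.factorial_pos)
  refine (mul_le_of_le_one_left (norm_nonneg _) h1).trans ?_
  have h2 := intervalIntegral.norm_integral_le_of_norm_le_const (a := 0) (b := 1)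
    (C := M * ‖x‖ ^ (n + 1))
    (f := fun t : ℝ => (1 - t) ^ n • iteratedFDeriv ℝ (n + 1) G (y + t • -x) fun _ => -x) ?_
  · simpa using h2
  intro t ht
  rw [uIoc_of_le zero_le_one] at ht
  have ht0 : 0 ≤ 1 - t := by linarith [ht.2]
  rw [norm_smul, norm_pow, Real.norm_of_nonneg ht0]
  refine (mul_le_of_le_one_left (norm_nonneg _)
    (pow_le_one₀ ht0 (by linarith [ht.1]))).trans ?_
  have h3 : y + t • -x = y - t • x := by rw [smul_neg, sub_eq_add_neg]
  rw [h3]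
  have h4 : ‖t • x‖ ≤ r := by
    rw [norm_smul, Real.norm_of_nonneg ht.1.le]
    exact (mul_le_of_le_one_left (norm_nonneg _) ht.2).trans hx
  have := (iteratedFDeriv ℝ (n + 1) G (y - t • x)).le_of_opNorm_le (h _ h4) fun _ => -x
  simpa using this

end taylor

/-! ### Vanishing moments annihilate Taylor terms -/

section moments

variable {d : ℕ} {W : Type} [NormedAddCommGroup W] [NormedSpace ℝ W] [NormedSpace ℂ W]

theorem integrable_schwartz_smul_diag (ρ : 𝓢(E d, ℂ)) {n : ℕ} (A : E d [×n]→L[ℝ] W) :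
    Integrable fun z => ρ z • A fun _ => z := by
  refine ((ρ.integrable_pow_mul volume n).const_mul ‖A‖).mono'
    ((ρ.continuous.smul (A.cont.comp (by fun_prop))).aestronglyMeasurable)
    (Eventually.of_forall fun z => ?_)
  rw [norm_smul]
  calc ‖ρ z‖ * ‖A fun _ => z‖ ≤ ‖ρ z‖ * (‖A‖ * ‖z‖ ^ n) := by
        gcongr
        simpa using A.le_opNorm fun _ => z
    _ = ‖A‖ * (‖z‖ ^ n * ‖ρ z‖) := by ring

variable [IsScalarTower ℝ ℂ W]

theorem real_smul_eq (r : ℝ) (v : W) : (r : ℂ) • v = r • v := algebraMap_smul ℂ r v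

/-- In coordinates the diagonal of `A` is a combination of monomials of degree `n`. The exponent of
`z i` is the number of slots `j` with `f j = i`. -/
theorem integral_schwartz_smul_diag [CompleteSpace W] {ρ : 𝓢(E d, ℂ)}
    (hρ : ∀ m : Fin d → ℕ, m ≠ 0 → ∫ x, ((∏ i, x i ^ m i : ℝ) : ℂ) * ρ x = 0)
    {n : ℕ} (hn : n ≠ 0) (A : E d [×n]→L[ℝ] W) : ∫ z, ρ z • (A fun _ => z) = 0 := by
  have hprod : ∀ (f : Fin n → Fin d) (z : E d),
      ∏ j, z (f j) = ∏ i, z i ^ (Finset.univ.filter fun j => f j = i).card := fun f z => by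
    rw [← Finset.prod_fiberwise' Finset.univ f (fun i => z i)]
    simp
  have hterm : ∀ (f : Fin n → Fin d) (z : E d) (v : W), ρ z • (∏ j, z (f j)) • v =
      (((∏ i, z i ^ (Finset.univ.filter fun j => f j = i).card : ℝ) : ℂ) * ρ z) • v :=
    fun f z v => by
      rw [← hprod, mul_comm, mul_smul, real_smul_eq]
  have hint : ∀ f : Fin n → Fin d, Integrable fun z : E d =>
      ((∏ i, z i ^ (Finset.univ.filter fun j => f j = i).card : ℝ) : ℂ) * ρ z := fun f => by
    refine (ρ.integrable_pow_mul volume n).mono' (Continuous.aestronglyMeasurable (by fun_prop))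
      (Eventually.of_forall fun z => ?_)
    rw [norm_mul, ← hprod, Complex.norm_real, norm_prod]
    gcongr
    exact (Finset.prod_le_prod (fun _ _ => norm_nonneg _)
      (fun j _ => PiLp.norm_apply_le z (f j))).trans (by simp)
  simp_rw [diag_eq_sum A, Finset.smul_sum, hterm]
  rw [integral_finsetSum _ fun f _ => (hint f).smul_const _]
  refine Finset.sum_eq_zero fun f _ => ?_
  rw [integral_smul_const, hρ, zero_smul]
  intro h0
  have h1 := congrFun h0 (f ⟨0, Nat.pos_of_ne_zero hn⟩)
  rw [Pi.zero_apply, Finset.card_eq_zero] at h1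
  exact Finset.notMem_empty (⟨0, Nat.pos_of_ne_zero hn⟩ : Fin n) (h1 ▸ by simp)

theorem integrable_taylorPoly (ρ : 𝓢(E d, ℂ)) (G : E d → W) (y : E d) (n : ℕ) (c : ℝ) :
    Integrable fun z => ρ z • taylorPoly G y n (c • z) := by
  simp_rw [taylorPoly, Finset.smul_sum]
  refine integrable_finsetSum _ fun k _ => ?_
  refine ((integrable_schwartz_smul_diag ρ (iteratedFDeriv ℝ k G y)).smul
    ((k.factorial : ℝ)⁻¹ * c ^ k)).congr (Eventually.of_forall fun z => ?_)
  have h := (iteratedFDeriv ℝ k G y).map_smul_univ (fun _ => c) (fun _ => z)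
  simp only [Finset.prod_const, Finset.card_univ, Fintype.card_fin] at h
  simp only [Pi.smul_apply]
  rw [h, mul_smul, smul_comm (ρ z), smul_comm (ρ z)]

theorem integral_taylorPoly [CompleteSpace W] {ρ : 𝓢(E d, ℂ)} (hρ_int : ∫ x, ρ x = 1)
    (hρ : ∀ m : Fin d → ℕ, m ≠ 0 → ∫ x, ((∏ i, x i ^ m i : ℝ) : ℂ) * ρ x = 0)
    (G : E d → W) (y : E d) (n : ℕ) (c : ℝ) :
    ∫ z, ρ z • taylorPoly G y n (c • z) = G y := by
  have hterm : ∀ (k : ℕ) (z : E d),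
      ρ z • ((k.factorial : ℝ)⁻¹) • (iteratedFDeriv ℝ k G y fun _ => c • z) =
        ((k.factorial : ℝ)⁻¹ * c ^ k) • ρ z • iteratedFDeriv ℝ k G y fun _ => z := fun k z => by
    have h := (iteratedFDeriv ℝ k G y).map_smul_univ (fun _ => c) (fun _ => z)
    simp only [Finset.prod_const, Finset.card_univ, Fintype.card_fin] at h
    rw [h, mul_smul, smul_comm (ρ z), smul_comm (ρ z)]
  simp_rw [taylorPoly, Finset.smul_sum, hterm]
  have hint : ∀ k, Integrable fun z => ((k.factorial : ℝ)⁻¹ * c ^ k) •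
      ρ z • iteratedFDeriv ℝ k G y fun _ => z := fun k =>
    (integrable_schwartz_smul_diag ρ (iteratedFDeriv ℝ k G y)).smul _
  rw [integral_finsetSum _ fun k _ => hint k,
    Finset.sum_range_succ', Finset.sum_eq_zero fun k _ => ?_]
  · simp [integral_smul_const, hρ_int]
  · rw [integral_smul, integral_schwartz_smul_diag hρ k.succ_ne_zero, smul_zero]

end moments

/-! ### Approximation order of the cut-off mollifier -/

section mollifier

variable {d : ℕ}

/-- Squaring `|ln √ε| √ε < 1` gives `(ln ε)^2 ε < 4`; one more factor `ε` remains. -/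
theorem sq_abs_log_mul_self_le {ε : ℝ} (h0 : 0 < ε) (h1 : ε ≤ 1) :
    (|Real.log ε| * ε) ^ 2 ≤ 4 * ε := by
  have hs := Real.abs_log_mul_self_lt (√ε) (Real.sqrt_pos.2 h0) (Real.sqrt_le_one.2 h1)
  rw [Real.log_sqrt h0.le] at hs
  have h2 := (sq_lt_one_iff_abs_lt_one _).2 hs
  have h3 : √ε ^ 2 = ε := Real.sq_sqrt h0.le
  have h4 : (Real.log ε / 2 * √ε) ^ 2 = Real.log ε ^ 2 * ε / 4 := by
    rw [mul_pow, h3]; ring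
  rw [h4] at h2
  rw [mul_pow, sq_abs]
  nlinarith

theorem one_le_abs_log {ε : ℝ} (h0 : 0 < ε) (h1 : ε ≤ Real.exp (-1)) : 1 ≤ |Real.log ε| := by
  have : Real.log ε ≤ -1 := (Real.log_le_iff_le_exp h0).2 h1
  rw [abs_of_nonpos (by linarith)]
  linarith

theorem integrable_one_add_pow_mul (ρ : 𝓢(E d, ℂ)) (n : ℕ) :
    Integrable fun z => (1 + ‖z‖) ^ n * ‖ρ z‖ := by
  simp_rw [add_pow, Finset.sum_mul]
  refine integrable_finsetSum _ fun k _ => ?_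
  refine ((ρ.integrable_pow_mul volume (n - k)).const_mul (n.choose k : ℝ)).congr
    (Eventually.of_forall fun z => ?_)
  simp only [one_pow]
  ring

/-- A cut-off mollifier with vanishing moments reproduces smooth functions up to an error of
arbitrarily high order. -/
theorem exists_norm_integral_sub_le {ρ : 𝓢(E d, ℂ)} (hρ_int : ∫ x, ρ x = 1)
    (hρ : ∀ m : Fin d → ℕ, m ≠ 0 → ∫ x, ((∏ i, x i ^ m i : ℝ) : ℂ) * ρ x = 0) (n : ℕ) :
    ∃ C : ℝ, 0 ≤ C ∧ ∀ {W : Type} [NormedAddCommGroup W] [NormedSpace ℝ W] [NormedSpace ℂ W]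
      [IsScalarTower ℝ ℂ W] [CompleteSpace W] {G : E d → W},
      ContDiff ℝ ∞ G → ∀ {y : E d} {M : ℝ},
      (∀ k ≤ n + 1, ∀ x, ‖x‖ ≤ 2 → ‖iteratedFDeriv ℝ k G (y - x)‖ ≤ M) →
      ∀ {ε : ℝ}, 0 < ε → ε ≤ Real.exp (-1) → ∀ {κ : E d → ℝ}, Continuous κ →
      (∀ x, 0 ≤ κ x ∧ κ x ≤ 1) → (∀ x, |Real.log ε| * ‖x‖ ≤ 1 → κ x = 1) →
      (∀ x, 2 ≤ |Real.log ε| * ‖x‖ → κ x = 0) →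
      ‖(∫ z, (ρ z * κ (ε • z)) • G (y - ε • z)) - G y‖ ≤ C * M * ε ^ (n + 1) := by
  -- Of the exponent, `n + 1` covers the growth of the Taylor polynomial and `2 * (n + 1)` pays for
  -- the cut-off.
  set B : ℝ := ∫ z, (1 + ‖z‖) ^ (3 * (n + 1)) * ‖ρ z‖
  have hB : 0 ≤ B := integral_nonneg fun z => by positivity
  refine ⟨(1 + (n + 1) * 4 ^ (n + 1)) * B, by positivity, ?_⟩
  intro W _ _ _ _ _ G hG y M hM ε h0 h1 κ hκ hκ01 hκ1 hκ0
  have hM0 : 0 ≤ M := (norm_nonneg _).trans (hM 0 (Nat.zero_le _) 0 (by simp))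
  have hlog := one_le_abs_log h0 h1
  have hε1 : ε ≤ 1 := h1.trans (Real.exp_le_one_iff.2 (by norm_num))
  have hpt : ∀ z : E d, ‖κ (ε • z) • G (y - ε • z) - taylorPoly G y n ((-ε) • z)‖ ≤
      M * ε ^ (n + 1) * (1 + (n + 1) * 4 ^ (n + 1)) * (1 + ‖z‖) ^ (3 * (n + 1)) := by
    intro z
    set x := ε • z with hx
    have hxz : ‖x‖ = ε * ‖z‖ := by rw [hx, norm_smul, Real.norm_of_nonneg h0.le]
    have hz0 := norm_nonneg z
    have hxz' : ‖x‖ ≤ ‖z‖ := hxz ▸ mul_le_of_le_one_left hz0 hε1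
    rw [neg_smul, ← hx]
    set P := taylorPoly G y n (-x)
    have hsplit : κ x • G (y - x) - P = κ x • (G (y - x) - P) + (κ x - 1) • P := by
      rw [smul_sub, sub_smul, one_smul]; abel
    have hfirst : ‖κ x • (G (y - x) - P)‖ ≤ M * ε ^ (n + 1) * (1 + ‖z‖) ^ (3 * (n + 1)) := by
      by_cases hx2 : 2 ≤ |Real.log ε| * ‖x‖
      · rw [hκ0 x hx2, zero_smul, norm_zero]; positivity
      have hx3 : ‖x‖ ≤ 2 := by nlinarith [norm_nonneg x]
      rw [norm_smul, Real.norm_of_nonneg (hκ01 x).1]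
      refine (mul_le_of_le_one_left (norm_nonneg _) (hκ01 x).2).trans ?_
      refine (norm_sub_taylorPoly_le hG (hM (n + 1) le_rfl) hx3).trans ?_
      rw [hxz, mul_pow, ← mul_assoc]
      refine mul_le_mul_of_nonneg_left ?_ (by positivity)
      exact (pow_le_pow_left₀ hz0 (by linarith) _).trans
        (pow_le_pow_right₀ (by linarith) (by omega))
    have hsecond : ‖(κ x - 1) • P‖ ≤
        M * ε ^ (n + 1) * ((n + 1) * 4 ^ (n + 1)) * (1 + ‖z‖) ^ (3 * (n + 1)) := by
      by_cases hx1 : |Real.log ε| * ‖x‖ ≤ 1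
      · rw [hκ1 x hx1, sub_self, zero_smul, norm_zero]; positivity
      have hk : ‖κ x - 1‖ ≤ 1 := by
        rw [Real.norm_eq_abs, abs_le]
        constructor <;> linarith [(hκ01 x).1, (hκ01 x).2]
      have hP : ‖P‖ ≤ (n + 1) * M * (1 + ‖z‖) ^ n := by
        refine (norm_taylorPoly_le (fun k hk => by
          simpa using hM k (by omega) 0 (by simp)) (-x)).trans ?_
        rw [norm_neg]
        gcongr
      -- Where `κ x` may differ from `1`, `|ln ε| ε ‖z‖ > 1`. Its power `2 * (n + 1)` trades growth
      -- in `z` for `ε ^ (n + 1)`.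
      have hbig : 1 ≤ (4 * ε) ^ (n + 1) * (1 + ‖z‖) ^ (2 * (n + 1)) := by
        calc (1 : ℝ) ≤ (|Real.log ε| * ‖x‖) ^ (2 * (n + 1)) := one_le_pow₀ (not_le.1 hx1).le
          _ = ((|Real.log ε| * ε) ^ 2) ^ (n + 1) * ‖z‖ ^ (2 * (n + 1)) := by
            rw [hxz, ← mul_assoc, mul_pow, pow_mul]
          _ ≤ (4 * ε) ^ (n + 1) * (1 + ‖z‖) ^ (2 * (n + 1)) := by
            gcongr
            · exact sq_abs_log_mul_self_le h0 hε1
            · linarith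
      rw [norm_smul]
      calc ‖κ x - 1‖ * ‖P‖ ≤ ‖P‖ := mul_le_of_le_one_left (norm_nonneg _) hk
        _ ≤ (n + 1) * M * (1 + ‖z‖) ^ n := hP
        _ ≤ ((n + 1) * M * (1 + ‖z‖) ^ n) * ((4 * ε) ^ (n + 1) * (1 + ‖z‖) ^ (2 * (n + 1))) :=
          le_mul_of_one_le_right (by positivity) hbig
        _ ≤ ((n + 1) * M * (1 + ‖z‖) ^ (n + 1)) *
            ((4 * ε) ^ (n + 1) * (1 + ‖z‖) ^ (2 * (n + 1))) := by
          gcongr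
          · linarith
          · omega
        _ = _ := by ring
    rw [hsplit]
    refine (norm_add_le _ _).trans ((add_le_add hfirst hsecond).trans (le_of_eq ?_))
    ring
  have hbd : ∀ z : E d, ‖ρ z • (κ (ε • z) • G (y - ε • z) - taylorPoly G y n ((-ε) • z))‖ ≤
      M * ε ^ (n + 1) * (1 + (n + 1) * 4 ^ (n + 1)) * ((1 + ‖z‖) ^ (3 * (n + 1)) * ‖ρ z‖) := by
    intro z
    rw [norm_smul, mul_comm, ← mul_assoc]
    exact mul_le_mul_of_nonneg_right (hpt z) (norm_nonneg _)
  have hbint := (integrable_one_add_pow_mul ρ (3 * (n + 1))).const_mul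
    (M * ε ^ (n + 1) * (1 + (n + 1) * 4 ^ (n + 1)))
  have hPint := integrable_taylorPoly ρ G y n (-ε)
  have hcont : Continuous fun z => ρ z • κ (ε • z) • G (y - ε • z) :=
    ρ.continuous.smul ((hκ.comp (by fun_prop)).smul (hG.continuous.comp (by fun_prop)))
  have hdiff : Integrable fun z =>
      ρ z • (κ (ε • z) • G (y - ε • z) - taylorPoly G y n ((-ε) • z)) := by
    refine hbint.mono' ?_ (Eventually.of_forall hbd)
    simp_rw [smul_sub]
    exact hcont.aestronglyMeasurable.sub hPint.aestronglyMeasurable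
  have heq : (∫ z, (ρ z * κ (ε • z)) • G (y - ε • z)) - G y =
      ∫ z, ρ z • (κ (ε • z) • G (y - ε • z) - taylorPoly G y n ((-ε) • z)) := by
    rw [← integral_taylorPoly hρ_int hρ G y n (-ε), ← integral_sub _ hPint]
    · refine integral_congr_ae (Eventually.of_forall fun z => ?_)
      simp only [smul_sub, mul_smul, real_smul_eq]
    · refine (hdiff.add hPint).congr (Eventually.of_forall fun z => ?_)
      simp only [Pi.add_apply, smul_sub, mul_smul, real_smul_eq, sub_add_cancel]
  rw [heq]
  refine (norm_integral_le_of_norm_le hbint (Eventually.of_forall hbd)).trans (le_of_eq ?_)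
  rw [integral_const_mul]
  ring

end mollifier

/-! ### Scaling, support and derivative bounds of `θ_ε` -/

section theta

variable {d : ℕ}

theorem integral_scaled_smul {W : Type} [NormedAddCommGroup W] [NormedSpace ℝ W]
    [NormedSpace ℂ W] [IsScalarTower ℝ ℂ W] (ρ : E d → ℂ) (κ : E d → ℝ) (G : E d → W) (y : E d)
    {ε : ℝ} (h0 : 0 < ε) :
    ∫ x, ((((ε ^ d)⁻¹ : ℝ) : ℂ) * ρ (ε⁻¹ • x) * (κ x : ℂ)) • G (y - x) =
      ∫ z, (ρ z * κ (ε • z)) • G (y - ε • z) := by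
  have h := Measure.integral_comp_smul volume
    (fun x : E d => (ρ (ε⁻¹ • x) * (κ x : ℂ)) • G (y - x)) ε
  simp only [inv_smul_smul₀ h0.ne', finrank_euclideanSpace_fin] at h
  rw [h, abs_of_pos (by positivity), ← integral_smul]
  refine integral_congr_ae (Eventually.of_forall fun x => ?_)
  simp only [mul_smul, real_smul_eq]

variable {ρ : 𝓢(E d, ℂ)} {χ : 𝓓((⊤ : Opens (E d)), ℝ)}

theorem theta_apply (ε : Set.Ioo (0 : ℝ) 1) (x : E d) : theta ρ χ ε x =
    (((ε : ℝ) ^ d)⁻¹ : ℝ) * ρ ((ε : ℝ)⁻¹ • x) * (χ (|Real.log ε| • x) : ℂ) := rfl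

/-- Since `|ln ε| ≥ 1` for `ε ≤ e⁻¹`, a single radius `2` works for all small `ε`. -/
theorem theta_eq_zero (hχ_zero : ∀ x ∉ Metric.ball (0 : E d) 2, χ x = 0)
    {ε : Set.Ioo (0 : ℝ) 1} (hε : (ε : ℝ) ≤ Real.exp (-1)) (x : E d) (hx : 2 ≤ ‖x‖) :
    theta ρ χ ε x = 0 := by
  rw [theta_apply, hχ_zero, Complex.ofReal_zero, mul_zero]
  rw [mem_ball_zero_iff, not_lt, norm_smul, Real.norm_eq_abs, abs_abs]
  nlinarith [one_le_abs_log ε.2.1 hε]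

theorem abs_log_le_inv {ε : ℝ} (h0 : 0 < ε) (h1 : ε ≤ 1) : |Real.log ε| ≤ ε⁻¹ := by
  have h := Real.abs_log_mul_self_lt ε h0 h1
  rw [abs_mul, abs_of_pos h0] at h
  rw [← one_div, le_div_iff₀ h0]
  exact h.le

-- By the Leibniz rule each derivative costs `ε⁻¹` on `ρ` or `|ln ε| ≤ ε⁻¹` on `χ`; the
-- normalization contributes `ε^(-d)`.
variable (ρ χ) in
theorem exists_norm_iteratedFDeriv_theta_le (k : ℕ) :
    ∃ C : ℝ, 0 ≤ C ∧ ∀ (ε : Set.Ioo (0 : ℝ) 1) (x : E d),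
      ‖iteratedFDeriv ℝ k (theta ρ χ ε) x‖ ≤ C * ((ε : ℝ) ^ (d + k))⁻¹ := by
  have hχc : ContDiff ℝ ∞ fun x : E d => (χ x : ℂ) :=
    Complex.ofRealCLM.contDiff.comp χ.contDiff
  have hχs : HasCompactSupport fun x : E d => (χ x : ℂ) :=
    HasCompactSupport.comp_left (g := fun t : ℝ => (t : ℂ)) χ.hasCompactSupport
      Complex.ofReal_zero
  have hb : ∀ i : ℕ, ∃ C, ∀ x, ‖iteratedFDeriv ℝ i (fun x : E d => (χ x : ℂ)) x‖ ≤ C := fun i =>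
    (hχc.continuous_iteratedFDeriv (by exact_mod_cast le_top)).bounded_above_of_compact_support
      (hχs.iteratedFDeriv i)
  choose X hX using hb
  have hX0 : ∀ i, 0 ≤ X i := fun i => (norm_nonneg _).trans (hX i 0)
  refine ⟨∑ i ∈ Finset.range (k + 1), k.choose i * SchwartzMap.seminorm ℝ 0 i ρ * X (k - i),
    Finset.sum_nonneg fun i _ => by have := hX0 (k - i); positivity, fun ε x => ?_⟩
  have h0 := ε.2.1
  have hlog := abs_log_le_inv h0 ε.2.2.le
  have hn : ∀ i : ℕ, (i : WithTop ℕ∞) ≤ ∞ := fun i => by exact_mod_cast le_top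
  have hf : ContDiff ℝ ∞ fun x : E d => ρ ((ε : ℝ)⁻¹ • x) :=
    (ρ.smooth ⊤).comp (contDiff_const_smul _)
  have hg : ContDiff ℝ ∞ fun x : E d => (χ (|Real.log ε| • x) : ℂ) :=
    hχc.comp (contDiff_const_smul _)
  have hθ : ⇑(theta ρ χ ε) = (((ε : ℝ) ^ d)⁻¹) •
      fun x : E d => ρ ((ε : ℝ)⁻¹ • x) * (χ (|Real.log ε| • x) : ℂ) := by
    funext x
    rw [theta_apply, Pi.smul_apply, Complex.real_smul, mul_assoc]
  rw [hθ, iteratedFDeriv_const_smul_apply ((hf.mul hg).of_le (hn k)).contDiffAt, norm_smul,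
    Real.norm_of_nonneg (by positivity)]
  have hprod := norm_iteratedFDeriv_mul_le hf hg x (hn k)
  have hterm : ∀ i ∈ Finset.range (k + 1),
      (k.choose i : ℝ) * ‖iteratedFDeriv ℝ i (fun x : E d => ρ ((ε : ℝ)⁻¹ • x)) x‖ *
        ‖iteratedFDeriv ℝ (k - i) (fun x : E d => (χ (|Real.log ε| • x) : ℂ)) x‖ ≤
      k.choose i * SchwartzMap.seminorm ℝ 0 i ρ * X (k - i) * ((ε : ℝ) ^ k)⁻¹ := by
    intro i hi
    have hi : i ≤ k := Nat.le_of_lt_succ (Finset.mem_range.1 hi)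
    rw [congrFun (iteratedFDeriv_comp_const_smul (𝕜 := ℝ) (i := i) ((ε : ℝ)⁻¹)
        ((ρ.smooth ⊤).of_le (hn i))) x,
      congrFun (iteratedFDeriv_comp_const_smul (𝕜 := ℝ) (i := k - i) (|Real.log ε|)
        (f := fun x : E d => (χ x : ℂ)) (hχc.of_le (hn _))) x,
      norm_smul, norm_smul, norm_pow, norm_pow, Real.norm_of_nonneg (inv_nonneg.2 h0.le),
      Real.norm_of_nonneg (abs_nonneg _)]
    have h1 := ρ.norm_iteratedFDeriv_le_seminorm ℝ i ((ε : ℝ)⁻¹ • x)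
    have h2 := hX (k - i) (|Real.log ε| • x)
    have h3 : |Real.log ε| ^ (k - i) ≤ ((ε : ℝ)⁻¹) ^ (k - i) :=
      pow_le_pow_left₀ (abs_nonneg _) hlog _
    calc _ ≤ (k.choose i : ℝ) * (((ε : ℝ)⁻¹) ^ i * SchwartzMap.seminorm ℝ 0 i ρ) *
          (((ε : ℝ)⁻¹) ^ (k - i) * X (k - i)) := by gcongr
      _ = k.choose i * SchwartzMap.seminorm ℝ 0 i ρ * X (k - i) *
          (((ε : ℝ)⁻¹) ^ i * ((ε : ℝ)⁻¹) ^ (k - i)) := by ring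
      _ = _ := by rw [← pow_add, Nat.add_sub_cancel' hi, inv_pow]
  refine (mul_le_mul_of_nonneg_left (hprod.trans (Finset.sum_le_sum hterm))
    (by positivity)).trans (le_of_eq ?_)
  rw [← Finset.sum_mul, pow_add, mul_inv]
  ring

end theta

/-! ### Asymptotics as `ε → 0` -/

section asymptotics

variable {d : ℕ}

theorem tendsto_toZero : Tendsto (fun ε : I01 => (ε : ℝ)) toZero (𝓝 0) := tendsto_comap

theorem eventually_toZero_le {c : ℝ} (hc : 0 < c) : ∀ᶠ ε : I01 in toZero, (ε : ℝ) ≤ c :=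
  tendsto_toZero.eventually (eventually_le_nhds hc)

instance : NeBot toZero := by
  refine comap_neBot_iff.2 fun s hs => ?_
  obtain ⟨r, hr, hs⟩ := Metric.mem_nhds_iff.1 hs
  refine ⟨⟨min (r / 2) 1, by positivity, min_le_right _ _⟩, hs ?_⟩
  rw [mem_ball_zero_iff, Real.norm_of_nonneg (by positivity)]
  exact (min_le_left _ _).trans_lt (half_lt_self hr)

theorem exp_neg_one_lt_one : Real.exp (-1) < 1 := by
  simp

theorem pow_succ_isLittleO (p : ℕ) :
    (fun ε : I01 => (ε : ℝ) ^ (p + 1)) =o[toZero] fun ε : I01 => (ε : ℝ) ^ p := by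
  rw [Asymptotics.isLittleO_iff_tendsto'
    (Eventually.of_forall fun ε h => absurd h (pow_ne_zero _ ε.2.1.ne'))]
  refine tendsto_toZero.congr fun ε => ?_
  rw [pow_succ, mul_div_cancel_left₀ _ (pow_ne_zero _ ε.2.1.ne')]

theorem inv_pow_isLittleO (p : ℕ) :
    (fun ε : I01 => ((ε : ℝ) ^ p)⁻¹) =o[toZero] fun ε : I01 => ((ε : ℝ) ^ (p + 1))⁻¹ := by
  rw [Asymptotics.isLittleO_iff_tendsto'
    (Eventually.of_forall fun ε h => absurd h (inv_ne_zero (pow_ne_zero _ ε.2.1.ne')))]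
  refine tendsto_toZero.congr fun ε => ?_
  have := ε.2.1.ne'
  field_simp
  ring

theorem pSemi_isLittleO {u : Net d} {K : Compacts (E d)} {l : ℕ} {g h : I01 → ℝ} (C : ℝ)
    (hg : ∀ ε, 0 ≤ g ε) (hu : ∀ᶠ ε in toZero, pSemi K l (u ε) ≤ C * g ε)
    (hgh : g =o[toZero] h) : (fun ε => pSemi K l (u ε)) =o[toZero] h := by
  refine Asymptotics.IsBigO.trans_isLittleO (Asymptotics.IsBigO.of_bound C ?_) hgh
  filter_upwards [hu] with ε hε
  rwa [Real.norm_of_nonneg (pSemi_nonneg K l _), Real.norm_of_nonneg (hg ε)]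

theorem isNegligible_of_eventually_eq_zero {u : Net d} (hu : ∀ ε, ContDiff ℝ ∞ (u ε))
    (h : ∀ᶠ ε in toZero, u ε = 0) : IsNegligible u := by
  refine ⟨hu, fun l K p => ?_⟩
  refine (isNegligible_zero.2 l K p).congr' ?_ EventuallyEq.rfl
  filter_upwards [h] with ε hε
  rw [hε]
  rfl

theorem exists_compact_subset_ball (K : Compacts (E d)) : ∃ R : ℝ, ∀ x ∈ K, ‖x‖ < R := by
  obtain ⟨R, hR⟩ := K.isCompact.isBounded.subset_ball 0
  exact ⟨R, fun x hx => mem_ball_zero_iff.1 (hR hx)⟩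

end asymptotics

/-! ### Moderateness and the linear map into the quotient -/

section embedding

variable {d : ℕ}

/-- `u` is the net of regularizations of `T`, with an arbitrary value at `ε = 1`. -/
def IsRegularization (ρ : 𝓢(E d, ℂ)) (χ : 𝓓((⊤ : Opens (E d)), ℝ)) (T : Distr d) (u : Net d) :
    Prop :=
  ∀ (ε : ℝ) (h0 : 0 < ε) (h1 : ε < 1), u ⟨ε, h0, h1.le⟩ = conv T (theta ρ χ ⟨ε, h0, h1⟩)

/-- The net of regularizations, completed by `0`. -/
def regNet (ρ : 𝓢(E d, ℂ)) (χ : 𝓓((⊤ : Opens (E d)), ℝ)) (T : Distr d) : Net d := fun ε =>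
  if h : (ε : ℝ) < 1 then conv T (theta ρ χ ⟨ε, ε.2.1, h⟩) else 0

variable {ρ : 𝓢(E d, ℂ)} {χ : 𝓓((⊤ : Opens (E d)), ℝ)} {T : Distr d} {u : Net d}

theorem isRegularization_regNet : IsRegularization ρ χ T (regNet ρ χ T) :=
  fun _ _ h1 => dif_pos h1

theorem regNet_one : regNet ρ χ T ⟨1, one_pos, le_rfl⟩ = 0 := dif_neg (lt_irrefl _)

theorem IsRegularization.contDiff (hu : IsRegularization ρ χ T u)
    (h1 : ContDiff ℝ ∞ (u ⟨1, one_pos, le_rfl⟩)) (ε : I01) : ContDiff ℝ ∞ (u ε) := by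
  rcases ε with ⟨ε, h0, hε⟩
  rcases hε.lt_or_eq with h | rfl
  · rw [hu ε h0 h]
    exact contDiff_conv T _
  · exact h1

theorem IsRegularization.isModerate (hχ_zero : ∀ x ∉ Metric.ball (0 : E d) 2, χ x = 0)
    (hu : IsRegularization ρ χ T u) (h1 : ContDiff ℝ ∞ (u ⟨1, one_pos, le_rfl⟩)) :
    IsModerate u := by
  refine ⟨hu.contDiff h1, fun l K => ?_⟩
  obtain ⟨R, hR⟩ := exists_compact_subset_ball K
  obtain ⟨N, C, hC, hconv⟩ := exists_norm_iteratedFDeriv_conv_le T R 2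
  choose B hB0 hB using exists_norm_iteratedFDeriv_theta_le ρ χ
  set B' := ∑ k ∈ Finset.range (N + l + 1), B k
  have hB' : ∀ k ≤ N + l, B k ≤ B' := fun k hk =>
    Finset.single_le_sum (fun i _ => hB0 i) (Finset.mem_range.2 (Nat.lt_succ_of_le hk))
  -- The estimate is `O(ε^(-(d + N + l)))`; the extra `1` turns it into little-o.
  refine ⟨d + (N + l) + 1, pSemi_isLittleO (C * B') (fun ε => ?_) ?_
    (inv_pow_isLittleO (d + (N + l)))⟩
  · have := ε.2.1
    positivity
  filter_upwards [eventually_toZero_le (Real.exp_pos (-1))] with ε hε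
  have h0 := ε.2.1
  have hlt : (ε : ℝ) < 1 := hε.trans_lt exp_neg_one_lt_one
  have hB'0 : 0 ≤ B' := (hB0 0).trans (hB' 0 (Nat.zero_le _))
  have hM : 0 ≤ B' * ((ε : ℝ) ^ (d + (N + l)))⁻¹ := by positivity
  have hεu : u ε = conv T (theta ρ χ ⟨ε, h0, hlt⟩) := hu ε h0 hlt
  rw [hεu, mul_assoc]
  refine pSemi_le K l (by positivity) fun n hn x hx =>
    hconv _ (theta_eq_zero hχ_zero hε) n _ hM (fun k hk z => ?_) x (hR x hx)
  refine (hB k ⟨ε, h0, hlt⟩ z).trans ?_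
  refine mul_le_mul (hB' k (by omega)) ?_ (by positivity) hB'0
  exact inv_anti₀ (by positivity) (pow_le_pow_of_le_one h0.le hlt.le (by omega))

theorem IsRegularization.sub_regNet (hu : IsRegularization ρ χ T u)
    (h1 : ContDiff ℝ ∞ (u ⟨1, one_pos, le_rfl⟩)) : IsNegligible (u - regNet ρ χ T) := by
  refine isNegligible_of_eventually_eq_zero (fun ε => (hu.contDiff h1 ε).sub
    (isRegularization_regNet.contDiff (regNet_one ▸ contDiff_const) ε)) ?_
  filter_upwards [eventually_toZero_le (Real.exp_pos (-1))] with ε hε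
  have hlt : (ε : ℝ) < 1 := hε.trans_lt exp_neg_one_lt_one
  exact sub_eq_zero.2 ((hu ε ε.2.1 hlt).trans (isRegularization_regNet ε ε.2.1 hlt).symm)

theorem isModerate_regNet (hχ_zero : ∀ x ∉ Metric.ball (0 : E d) 2, χ x = 0) (T : Distr d) :
    IsModerate (regNet ρ χ T) :=
  isRegularization_regNet.isModerate hχ_zero (regNet_one ▸ contDiff_const)

theorem regNet_add (S T : Distr d) : regNet ρ χ (S + T) = regNet ρ χ S + regNet ρ χ T := by
  funext ε
  simp only [regNet, Pi.add_apply]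
  split_ifs
  · rfl
  · exact (add_zero _).symm

theorem regNet_smul (c : ℂ) (T : Distr d) : regNet ρ χ (c • T) = c • regNet ρ χ T := by
  funext ε
  simp only [regNet, Pi.smul_apply]
  split_ifs
  · rfl
  · exact (smul_zero _).symm

variable (ρ) in
/-- The embedding of the distributions into the simplified Colombeau algebra. -/
def embedding (hχ_zero : ∀ x ∉ Metric.ball (0 : E d) 2, χ x = 0) : Distr d →ₗ[ℂ] G d where
  toFun T := G.mk (regNet ρ χ T) (isModerate_regNet hχ_zero T)
  map_add' S T := congrArg (Ideal.Quotient.mk (Negligible d)) (Subtype.ext (regNet_add S T))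
  map_smul' c T := congrArg (Ideal.Quotient.mk (Negligible d)) (Subtype.ext (regNet_smul c T))

theorem mk_eq_mk_iff {u v : Net d} (hu : u ∈ Moderate d) (hv : v ∈ Moderate d) :
    G.mk u hu = G.mk v hv ↔ IsNegligible (u - v) :=
  Ideal.Quotient.mk_eq_mk_iff_sub_mem _ _

end embedding

/-! ### Agreement with the constant embedding on smooth functions -/

section smooth

variable {d : ℕ} {ρ : 𝓢(E d, ℂ)} {χ : 𝓓((⊤ : Opens (E d)), ℝ)}

/-- `C` is chosen before `W`, so that one constant serves the derivatives of all orders, whose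
target spaces differ. -/
theorem exists_norm_integral_theta_sub_le (hρ_int : ∫ x, ρ x = 1)
    (hρ : ∀ m : Fin d → ℕ, m ≠ 0 → ∫ x, ((∏ i, x i ^ m i : ℝ) : ℂ) * ρ x = 0)
    (hχ_range : ∀ x, 0 ≤ χ x ∧ χ x ≤ 1)
    (hχ_one : ∀ x ∈ Metric.closedBall (0 : E d) 1, χ x = 1)
    (hχ_zero : ∀ x ∉ Metric.ball (0 : E d) 2, χ x = 0) (n : ℕ) :
    ∃ C : ℝ, 0 ≤ C ∧ ∀ {W : Type} [NormedAddCommGroup W] [NormedSpace ℝ W] [NormedSpace ℂ W]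
      [IsScalarTower ℝ ℂ W] [CompleteSpace W] {G : E d → W},
      ContDiff ℝ ∞ G → ∀ {y : E d} {M : ℝ},
      (∀ k ≤ n + 1, ∀ x, ‖x‖ ≤ 2 → ‖iteratedFDeriv ℝ k G (y - x)‖ ≤ M) →
      ∀ {ε : Set.Ioo (0 : ℝ) 1}, (ε : ℝ) ≤ Real.exp (-1) →
      ‖(∫ x, theta ρ χ ε x • G (y - x)) - G y‖ ≤ C * M * (ε : ℝ) ^ (n + 1) := by
  obtain ⟨C, hC, h⟩ := exists_norm_integral_sub_le hρ_int hρ n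
  refine ⟨C, hC, fun hG y M hM ε hε => ?_⟩
  have hc : Continuous fun x => χ (|Real.log ε| • x) :=
    χ.continuous.comp (continuous_const_smul _)
  have hn : ∀ x : E d, ‖|Real.log ε| • x‖ = |Real.log ε| * ‖x‖ := fun x => by
    rw [norm_smul, Real.norm_eq_abs, abs_abs]
  have := h hG hM ε.2.1 hε hc (fun x => hχ_range _)
    (fun x hx => hχ_one _ (by rwa [mem_closedBall_zero_iff, hn]))
    (fun x hx => hχ_zero _ (by rwa [mem_ball_zero_iff, hn, not_lt]))
  rwa [← integral_scaled_smul ρ (fun x => χ (|Real.log ε| • x)) _ y ε.2.1] at this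

theorem conv_ofSmooth (f : SmoothFun d) (θ : Test d) :
    conv (ofSmooth f) θ = fun y => ∫ x, θ x • (f : E d → ℂ) (y - x) := by
  funext y
  rw [conv, ofSmooth_apply, ← integral_sub_left_eq_self _ volume y]
  refine integral_congr_ae (Eventually.of_forall fun x => ?_)
  have h : reflect θ y (y - x) = θ (y - (y - x)) := rfl
  simp only [h, sub_sub_cancel, smul_eq_mul, mul_comm]

theorem isNegligible_regNet_ofSmooth_sub (hρ_int : ∫ x, ρ x = 1)
    (hρ : ∀ m : Fin d → ℕ, m ≠ 0 → ∫ x, ((∏ i, x i ^ m i : ℝ) : ℂ) * ρ x = 0)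
    (hχ_range : ∀ x, 0 ≤ χ x ∧ χ x ≤ 1)
    (hχ_one : ∀ x ∈ Metric.closedBall (0 : E d) 1, χ x = 1)
    (hχ_zero : ∀ x ∉ Metric.ball (0 : E d) 2, χ x = 0) (f : SmoothFun d) :
    IsNegligible (regNet ρ χ (ofSmooth f) - fun _ => (f : E d → ℂ)) := by
  have hf : ContDiff ℝ ∞ (f : E d → ℂ) := f.2
  refine ⟨fun ε => ((isModerate_regNet hχ_zero (ofSmooth f)).1 ε).sub hf, fun l K p => ?_⟩
  obtain ⟨R, hR⟩ := exists_compact_subset_ball K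
  obtain ⟨C, hC, h⟩ :=
    exists_norm_integral_theta_sub_le hρ_int hρ hχ_range hχ_one hχ_zero p
  -- Degree `p` in the Taylor estimate gives `ε ^ (p + 1) = o(ε ^ p)`. It needs `p + 1` derivatives
  -- of `D^k f` with `k ≤ l`, at points within distance `2` of `K`.
  set M := pSemi (cball d (R + 2)) (p + 1 + l) (f : E d → ℂ)
  have hM0 : 0 ≤ M := pSemi_nonneg _ _ _
  refine pSemi_isLittleO (C * M) (fun ε => ?_) ?_ (pow_succ_isLittleO p)
  · have := ε.2.1
    positivity
  filter_upwards [eventually_toZero_le (Real.exp_pos (-1))] with ε hε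
  have h0 := ε.2.1
  have hlt : (ε : ℝ) < 1 := hε.trans_lt exp_neg_one_lt_one
  refine pSemi_le K l (by positivity) fun k hk y hy => ?_
  have hk' : (k : WithTop ℕ∞) ≤ ∞ := by exact_mod_cast le_top
  set θ := theta ρ χ ⟨ε, h0, hlt⟩
  have heq : (regNet ρ χ (ofSmooth f) - (fun _ => (f : E d → ℂ) : Net d)) ε =
      conv (ofSmooth f) θ - (f : E d → ℂ) := by
    rw [Pi.sub_apply]
    congr 1
    exact isRegularization_regNet ε h0 hlt
  rw [heq, iteratedFDeriv_sub_apply ((contDiff_conv _ θ).of_le hk').contDiffAt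
    (hf.of_le hk').contDiffAt, conv_ofSmooth, iteratedFDeriv_integral_smul_sub θ.continuous
    θ.hasCompactSupport hf]
  refine h (hf.iteratedFDeriv_right (by norm_cast)) (fun j hj x hx => ?_) hε
  rw [norm_iteratedFDeriv_iteratedFDeriv]
  refine le_pSemi _ _ hf (by omega) ?_
  refine mem_closedBall_zero_iff.2 ((norm_sub_le _ _).trans ?_)
  linarith [hR y hy]

end smooth

/-! ### Weak convergence `T ∗ θ_ε → T` and injectivity -/

section injective

variable {d : ℕ} {ρ : 𝓢(E d, ℂ)} {χ : 𝓓((⊤ : Opens (E d)), ℝ)}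

theorem integral_smul_reflect_comm (φ θ : Test d) (x : E d) :
    ∫ y, φ y • reflect θ 0 (x - y) = ∫ u, reflect θ 0 u • φ (x - u) := by
  rw [← integral_sub_left_eq_self _ volume x]
  refine integral_congr_ae (Eventually.of_forall fun u => ?_)
  simp [mul_comm]

/-- Both sides are the `k`-th derivative at `x` of the convolution of `φ` with the reflected `θ`,
the derivative falling on either factor. The sign `(-1) ^ k` is that of differentiating the
reflection. -/
theorem integral_smul_shift_apply (φ θ : Test d) (k : ℕ) (x : E d) :
    (∫ y, φ y • shift ((-1 : ℝ) ^ k • jet k θ) y) x =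
      ∫ u, reflect θ 0 u • iteratedFDeriv ℝ k φ (x - u) := by
  have hint : Integrable fun y => φ y • shift ((-1 : ℝ) ^ k • jet k θ) y :=
    (φ.continuous.smul (contDiff_shift _).continuous).integrable_of_hasCompactSupport
      φ.hasCompactSupport.smul_right
  have h1 := (BCF.eval ℂ x).integral_comp_comm hint
  rw [BCF.eval_apply] at h1
  rw [← h1]
  have h2 := congrFun (iteratedFDeriv_integral_smul_sub (reflect θ 0).continuous
    (reflect θ 0).hasCompactSupport φ.contDiff k) x
  rw [← h2]
  have h3 := congrFun (iteratedFDeriv_integral_smul_sub φ.continuous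
    φ.hasCompactSupport (reflect θ 0).contDiff k) x
  simp_rw [integral_smul_reflect_comm] at h3
  rw [h3]
  refine integral_congr_ae (Eventually.of_forall fun y => ?_)
  have h4 := iteratedFDeriv_comp_sub_left θ.contDiff k 0 (x - y)
  have h5 : iteratedFDeriv ℝ k (reflect θ 0) (x - y) =
    (-1 : ℝ) ^ k • iteratedFDeriv ℝ k θ (0 - (x - y)) := h4
  simp only [map_smul, BCF.eval_apply, shift_apply]
  rw [h5, zero_sub, neg_sub]
  rfl

theorem exists_norm_iteratedFDeriv_test_le (φ : Test d) (k : ℕ) :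
    ∃ C, ∀ x, ‖iteratedFDeriv ℝ k φ x‖ ≤ C :=
  (jet k φ).continuous.bounded_above_of_compact_support (jet k φ).hasCompactSupport

theorem exists_norm_integral_smul_shift_sub_le (hρ_even : ∀ x, ρ (-x) = ρ x)
    (hρ_int : ∫ x, ρ x = 1)
    (hρ : ∀ m : Fin d → ℕ, m ≠ 0 → ∫ x, ((∏ i, x i ^ m i : ℝ) : ℂ) * ρ x = 0)
    (hχ_range : ∀ x, 0 ≤ χ x ∧ χ x ≤ 1)
    (hχ_one : ∀ x ∈ Metric.closedBall (0 : E d) 1, χ x = 1)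
    (hχ_zero : ∀ x ∉ Metric.ball (0 : E d) 2, χ x = 0) (φ : Test d) (k : ℕ) :
    ∃ C, ∀ {ε : Set.Ioo (0 : ℝ) 1}, (ε : ℝ) ≤ Real.exp (-1) →
      ‖(∫ y, φ y • shift ((-1 : ℝ) ^ k • jet k (theta ρ χ ε)) y) - toBCF (jet k φ)‖ ≤
        C * ε := by
  -- `ρ` is even but `χ` need not be: reflecting `θ_ε` keeps `ρ` and replaces `χ` by `χ(-·)`, which
  -- satisfies the same hypotheses. Taylor degree `0` already gives the rate `O(ε)`.
  let χ' : 𝓓((⊤ : Opens (E d)), ℝ) :=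
    ⟨fun x => χ (-x), χ.contDiff.comp contDiff_neg,
      χ.hasCompactSupport.comp_homeomorph (Homeomorph.neg (E d)), fun _ _ => trivial⟩
  have hχ' : ∀ x, χ' x = χ (-x) := fun x => rfl
  have hθ : ∀ (ε : Set.Ioo (0 : ℝ) 1) (u : E d),
      reflect (theta ρ χ ε) 0 u = theta ρ χ' ε u := fun ε u => by
    have h : reflect (theta ρ χ ε) 0 u = theta ρ χ ε (0 - u) := rfl
    rw [h, zero_sub, theta_apply, theta_apply, hχ', smul_neg, smul_neg, hρ_even]
  obtain ⟨C, hC, h⟩ := exists_norm_integral_theta_sub_le hρ_int hρ (χ := χ')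
    (fun x => hχ_range (-x))
    (fun x hx => hχ_one _ (by simpa using hx)) (fun x hx => hχ_zero _ (by simpa using hx)) 0
  obtain ⟨M₀, hM₀⟩ := exists_norm_iteratedFDeriv_test_le φ k
  obtain ⟨M₁, hM₁⟩ := exists_norm_iteratedFDeriv_test_le φ (1 + k)
  have hM : 0 ≤ max M₀ M₁ := ((norm_nonneg _).trans (hM₀ 0)).trans (le_max_left _ _)
  refine ⟨C * max M₀ M₁, fun {ε} hε => ?_⟩
  have h0 := ε.2.1
  refine (BCF.norm_le (by positivity)).2 fun x => ?_
  rw [BCF.sub_apply, integral_smul_shift_apply, toBCF_apply, coe_jet]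
  simp_rw [hθ]
  have := h (φ.contDiff.iteratedFDeriv_right (m := ∞) (i := k) (by norm_cast)) (y := x)
    (M := max M₀ M₁) (fun j hj z _ => ?_) hε
  · simpa using this
  rw [norm_iteratedFDeriv_iteratedFDeriv]
  interval_cases j
  · rw [zero_add]
    exact (hM₀ _).trans (le_max_left _ _)
  · exact (hM₁ _).trans (le_max_right _ _)

/-- The bounded forms `L k` commute with the Bochner integral in `BCF`, which does the work of a
Fubini theorem for `T` and reduces the claim to sup-norm convergence of the mollified derivatives of
`φ`. -/
theorem exists_norm_integral_smul_conv_sub_le (hρ_even : ∀ x, ρ (-x) = ρ x)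
    (hρ_int : ∫ x, ρ x = 1)
    (hρ : ∀ m : Fin d → ℕ, m ≠ 0 → ∫ x, ((∏ i, x i ^ m i : ℝ) : ℂ) * ρ x = 0)
    (hχ_range : ∀ x, 0 ≤ χ x ∧ χ x ≤ 1)
    (hχ_one : ∀ x ∈ Metric.closedBall (0 : E d) 1, χ x = 1)
    (hχ_zero : ∀ x ∉ Metric.ball (0 : E d) 2, χ x = 0) (T : Distr d) (φ : Test d) :
    ∃ C, ∀ {ε : Set.Ioo (0 : ℝ) 1}, (ε : ℝ) ≤ Real.exp (-1) →
      ‖(∫ y, φ y • conv T (theta ρ χ ε) y) - T φ‖ ≤ C * ε := by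
  obtain ⟨R, hR⟩ := exists_forall_eq_zero φ
  obtain ⟨N, L, hL, hφ⟩ := exists_conv_eq_sum T R 2
  choose C hC using
    exists_norm_integral_smul_shift_sub_le hρ_even hρ_int hρ hχ_range hχ_one hχ_zero φ
  refine ⟨∑ k ∈ Finset.range N, ‖L k‖ * C k, fun {ε} hε => ?_⟩
  have hint : ∀ k, Integrable fun y => φ y • shift ((-1 : ℝ) ^ k • jet k (theta ρ χ ε)) y :=
    fun k => (φ.continuous.smul (contDiff_shift _).continuous).integrable_of_hasCompactSupport
      φ.hasCompactSupport.smul_right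
  have h1 : ∀ y, φ y • conv T (theta ρ χ ε) y = ∑ k ∈ Finset.range N,
      L k (φ y • shift ((-1 : ℝ) ^ k • jet k (theta ρ χ ε)) y) := fun y => by
    by_cases hy : R ≤ ‖y‖
    · simp [hR y hy]
    · rw [hL _ (theta_eq_zero hχ_zero hε) y (not_le.1 hy).le, Finset.smul_sum]
      simp_rw [map_smul]
  have h2 : T φ = ∑ k ∈ Finset.range N, L k (toBCF (jet k φ)) := hφ φ fun x hx => by
    rw [mem_closedBall_zero_iff]
    by_contra h
    exact hx (hR x (by linarith))
  simp_rw [h1]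
  rw [integral_finsetSum _ fun k _ => (L k).integrable_comp (hint k), h2,
    ← Finset.sum_sub_distrib, Finset.sum_mul]
  refine norm_sum_le_of_le _ fun k _ => ?_
  rw [(L k).integral_comp_comm (hint k), ← map_sub, mul_assoc]
  exact (L k).le_opNorm_of_le (hC k hε)

theorem eq_zero_of_isNegligible_regNet (hρ_even : ∀ x, ρ (-x) = ρ x)
    (hρ_int : ∫ x, ρ x = 1)
    (hρ : ∀ m : Fin d → ℕ, m ≠ 0 → ∫ x, ((∏ i, x i ^ m i : ℝ) : ℂ) * ρ x = 0)
    (hχ_range : ∀ x, 0 ≤ χ x ∧ χ x ≤ 1)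
    (hχ_one : ∀ x ∈ Metric.closedBall (0 : E d) 1, χ x = 1)
    (hχ_zero : ∀ x ∉ Metric.ball (0 : E d) 2, χ x = 0) {T : Distr d}
    (hT : IsNegligible (regNet ρ χ T)) : T = 0 := by
  ext φ
  obtain ⟨R, hR⟩ := exists_forall_eq_zero φ
  obtain ⟨C, hC⟩ := exists_norm_integral_smul_conv_sub_le hρ_even hρ_int hρ hχ_range hχ_one
    hχ_zero T φ
  have hφi : Integrable φ := φ.continuous.integrable_of_hasCompactSupport φ.hasCompactSupport
  -- Of negligibility only the case `l = 0`, `p = 0` is used: uniform convergence to `0` on a ball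
  -- containing the support of `φ`.
  have h1 : Tendsto (fun ε => pSemi (cball d R) 0 (regNet ρ χ T ε)) toZero (𝓝 0) := by
    simpa [Asymptotics.isLittleO_one_iff] using hT.2 0 (cball d R) 0
  have h2 : Tendsto (fun ε : I01 => (∫ y, ‖φ y‖) * pSemi (cball d R) 0 (regNet ρ χ T ε) + C * ε)
      toZero (𝓝 0) := by
    simpa using (h1.const_mul (∫ y, ‖φ y‖)).add (tendsto_toZero.const_mul C)
  refine norm_le_zero_iff.1 (ge_of_tendsto h2 ?_)
  filter_upwards [eventually_toZero_le (Real.exp_pos (-1))] with ε hε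
  have hlt : (ε : ℝ) < 1 := hε.trans_lt exp_neg_one_lt_one
  have h3 := hC (ε := ⟨ε, ε.2.1, hlt⟩) hε
  have heq : regNet ρ χ T ε = conv T (theta ρ χ ⟨ε, ε.2.1, hlt⟩) :=
    isRegularization_regNet ε ε.2.1 hlt
  have h4 : ‖∫ y, φ y • conv T (theta ρ χ ⟨ε, ε.2.1, hlt⟩) y‖ ≤
      (∫ y, ‖φ y‖) * pSemi (cball d R) 0 (regNet ρ χ T ε) := by
    rw [← integral_mul_const]
    refine norm_integral_le_of_norm_le (hφi.norm.mul_const _) (Eventually.of_forall fun y => ?_)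
    rw [norm_smul]
    by_cases hy : R ≤ ‖y‖
    · simp [hR y hy]
    · refine mul_le_mul_of_nonneg_left ?_ (norm_nonneg _)
      have := le_pSemi (cball d R) 0 (hT.1 ε) le_rfl
        (x := y) (mem_closedBall_zero_iff.2 (not_le.1 hy).le)
      rw [norm_iteratedFDeriv_zero] at this
      rw [← heq]
      exact this
  have h5 := norm_sub_norm_le (T φ) (∫ y, φ y • conv T (theta ρ χ ⟨ε, ε.2.1, hlt⟩) y)
  rw [norm_sub_rev] at h5
  linarith

end injective

end Colombeau

end

theorem mainTheorem3 (d : ℕ)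
    (ρ : 𝓢(Colombeau.E d, ℂ))
    (hρ_even : ∀ x, ρ (-x) = ρ x)
    (hρ_int : ∫ x, ρ x = 1)
    (hρ_mom : ∀ m : Fin d → ℕ, m ≠ 0 → ∫ x, ((∏ i, x i ^ m i : ℝ) : ℂ) * ρ x = 0)
    (χ : 𝓓((⊤ : Opens (Colombeau.E d)), ℝ))
    (hχ_range : ∀ x, 0 ≤ χ x ∧ χ x ≤ 1)
    (hχ_one : ∀ x ∈ Metric.closedBall (0 : Colombeau.E d) 1, χ x = 1)
    (hχ_zero : ∀ x ∉ Metric.ball (0 : Colombeau.E d) 2, χ x = 0) :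
    ∃ ι : Colombeau.Distr d →ₗ[ℂ] Colombeau.G d,
      -- the net `(T ∗ θ_ε)_ε`, completed by any smooth function at `ε = 1`, is a moderate net of
      -- smooth functions, and its class is `ι T`
      (∀ (T : Colombeau.Distr d) (u : Colombeau.Net d),
        (∀ (ε : ℝ) (h0 : 0 < ε) (h1 : ε < 1),
          u ⟨ε, h0, h1.le⟩ = Colombeau.conv T (Colombeau.theta ρ χ ⟨ε, h0, h1⟩)) →
        ContDiff ℝ ∞ (u ⟨1, one_pos, le_rfl⟩) →
        ∃ hu : u ∈ Colombeau.Moderate d, ι T = Colombeau.G.mk u hu) ∧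
      Function.Injective ι ∧
      ∀ f : Colombeau.SmoothFun d, ι (Colombeau.ofSmooth f) = Colombeau.sigma f := by
  have hmem : ∀ T, Colombeau.regNet ρ χ T ∈ Colombeau.Moderate d :=
    Colombeau.isModerate_regNet hχ_zero
  refine ⟨Colombeau.embedding ρ hχ_zero, fun T u hu h1 => ?_, ?_, fun f => ?_⟩
  · have hreg : Colombeau.IsRegularization ρ χ T u := hu
    exact ⟨hreg.isModerate hχ_zero h1,
      ((Colombeau.mk_eq_mk_iff _ (hmem T)).2 (hreg.sub_regNet h1)).symm⟩
  · refine (injective_iff_map_eq_zero _).2 fun T hT => ?_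
    exact Colombeau.eq_zero_of_isNegligible_regNet hρ_even hρ_int hρ_mom hχ_range hχ_one hχ_zero
      (Ideal.Quotient.eq_zero_iff_mem.1 hT)
  · exact (Colombeau.mk_eq_mk_iff (hmem _) _).2
      (Colombeau.isNegligible_regNet_ofSmooth_sub hρ_int hρ_mom hχ_range hχ_one hχ_zero f)
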